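/- Let $D$ be a finite connected bipartite graph (a dimer; nodes coloured black and white, multiple edges allowed) cellularly embedded in the oriented torus $T^2=\mathbb R^2/\mathbb Z^2$, i.e. every face (component of the complement) is an open disc; such an embedding is described combinatorially by the counterclockwise order of the edges around every node, together with the identification $H_1(T^2)\cong\mathbb Z^2$. A zigzag path is a closed path in $D$ that turns at every white node from the edge on which it arrives to the next edge in counterclockwise order, and at every black node to the next edge in clockwise order. Every edge $e$ is traversed exactly twice by zigzag paths, once in each direction, and is regarded as an intersection of the two (possibly equal) paths concerned. Every zigzag path $Z$ has a winding number $\mathbf w_Z\in\mathbb Z^2$, its class in $H_1(T^2)$. A node of valence $n$ has $n$ corners (pairs of consecutive edges), and exactly one zigzag path turns at each corner; let $\mathbf w_0,\dots,\mathbf w_{n-1}$ be the winding numbers of these paths in counterclockwise order of the corners. The node is called properly ordered if all $\mathbf w_i$ are nonzero, cyclically consecutive ones $\mathbf w_i,\mathbf w_{i+1}$ (the windings of the two paths that intersect on an edge at the node; $\mathbf w_0,\mathbf w_0$ if $n=1$) never have the same direction, and the directions of $\mathbf w_0,\dots,\mathbf w_{n-1}$ are, in this order, in strict counterclockwise circular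 order. The dimer is called properly ordered if all its nodes are. Let $P$ be the convex lattice polygon (possibly degenerate, unique up to translation) whose $(p,q)$-legs are the winding numbers of the zigzag paths: its sides are the vectors $\mathbf w_Z$, rotated by $90^\circ$ and laid tip to tail in the order of their directions, where vectors in the same direction form a single side and zero vectors contribute nothing. Then $D$ is properly ordered if and only if $D$ has no node of valence one and the number of faces of $D$ equals $2\,\mathrm{area}(P)$. -/

import Mathlib

open MeasureTheory

noncomputable section

/-- A bipartite graph (multiple edges allowed, no isolated nodes) cellularly embedded in a closed
oriented surface, given by its rotation system.  `E` is the set of edges; every edge has one white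
and one black endpoint.  `white e` (resp. `black e`) is the edge that follows `e` in
counterclockwise order around the white (resp. black) endpoint of `e`.  The surface is obtained by
gluing a disc to every face. -/
structure BipartiteMap (E : Type*) where
  white : Equiv.Perm E
  black : Equiv.Perm E

namespace BipartiteMap

variable {E : Type*} (D : BipartiteMap E)

/-- White nodes are the cycles of `white`. -/
abbrev WhiteNode : Type _ := Quotient (Equiv.Perm.SameCycle.setoid D.white)

/-- Black nodes are the cycles of `black`. -/
abbrev BlackNode : Type _ := Quotient (Equiv.Perm.SameCycle.setoid D.black)

abbrev Node : Type _ := D.WhiteNode ⊕ D.BlackNode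

/-- The white endpoint of an edge. -/
def whiteEnd (e : E) : D.WhiteNode := Quotient.mk _ e

/-- The black endpoint of an edge. -/
def blackEnd (e : E) : D.BlackNode := Quotient.mk _ e

/-- The underlying (simple) graph of the dimer. -/
def graph : SimpleGraph D.Node where
  Adj u v := ∃ e : E,
    (u = Sum.inl (D.whiteEnd e) ∧ v = Sum.inr (D.blackEnd e)) ∨
    (v = Sum.inl (D.whiteEnd e) ∧ u = Sum.inr (D.blackEnd e))
  symm := ⟨fun _ _ ⟨e, h⟩ => ⟨e, h.symm⟩⟩
  loopless := ⟨fun u ⟨e, h⟩ => by rcases h with ⟨h₁, h₂⟩ | ⟨h₁, h₂⟩ <;> simp [h₁] at h₂⟩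

/-- The number of edges at a node. -/
def valence : D.Node → ℕ
  | Sum.inl w => Nat.card {e : E // D.whiteEnd e = w}
  | Sum.inr b => Nat.card {e : E // D.blackEnd e = b}

/-- Walk along `e` from its white to its black endpoint, keeping a face on the left.  At the black
endpoint the boundary of that face continues along the edge `black⁻¹ e` that is next in clockwise
order, from black to white, and then along the edge `white⁻¹ (black⁻¹ e)`, from white to black
again. -/
def facePerm : Equiv.Perm E := D.white⁻¹ * D.black⁻¹

/-- Faces are the cycles of `facePerm`: a face corresponds to the set of edges which have it on
their left when they are traversed from white to black. -/
abbrev Face : Type _ := Quotient (Equiv.Perm.SameCycle.setoid D.facePerm)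

/-- The face to the left of `e`, traversed from white to black. -/
def leftFace (e : E) : D.Face := Quotient.mk _ e

/-- The face to the right of `e`, traversed from white to black. -/
def rightFace (e : E) : D.Face := Quotient.mk _ (D.black e)

def numFaces : ℕ := Nat.card D.Face

/-- A zigzag path turns from `e` to the counterclockwise next edge `white e` at a white node, follows
it to its black endpoint, turns there to the clockwise next edge `black⁻¹ (white e)`, and follows
that edge to its white endpoint. -/
def zigzagPerm : Equiv.Perm E := D.black⁻¹ * D.white

/-- Zigzag paths are the cycles of `zigzagPerm`; the edges in such a cycle are the edges that the
path traverses from black to white. -/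
abbrev Zigzag : Type _ := Quotient (Equiv.Perm.SameCycle.setoid D.zigzagPerm)

/-- The zigzag path that traverses `e` from black to white.  It contains the corner from `e` to
`white e` at the white endpoint of `e` and the corner from `black e` to `e` at the black endpoint
of `e`.  (The zigzag path that traverses `e` from white to black is
`zigzagOf (white⁻¹ e) = zigzagOf (black⁻¹ e)`.) -/
def zigzagOf (e : E) : D.Zigzag := Quotient.mk _ e

section Homology

variable [Fintype E]

open Classical in
/-- A cellular 1-chain `z`, where every edge is oriented from white to black, is a cycle if its
boundary vanishes at every node. -/
def IsCycle (z : E → ℤ) : Prop :=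
  (∀ w : D.WhiteNode, ∑ e with D.whiteEnd e = w, z e = 0) ∧
  (∀ b : D.BlackNode, ∑ e with D.blackEnd e = b, z e = 0)

/-- A cellular 1-chain is a boundary if it is the boundary of a 2-chain `c`; the boundary of a face
runs counterclockwise, so that it has the face on its left. -/
def IsBoundary (z : E → ℤ) : Prop :=
  ∃ c : D.Face → ℤ, ∀ e, z e = c (D.leftFace e) - c (D.rightFace e)

end Homology

/-- The wedge product `(a, b) ∧ (c, d) = ad - bc`. -/
def wedge (u v : ℤ × ℤ) : ℤ := u.1 * v.2 - u.2 * v.1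

/-- Suppose that the edge `e`, lifted to the plane, leads from its white endpoint to a point displaced
by `disp e`.  Start at the origin with the white endpoint of `e` and walk along the boundary of the
face to the left of `e`.  This is the position after `2 * k` steps, at the white endpoint of
`facePerm ^ k e`. -/
def facePos (disp : E → ℤ × ℤ) (e : E) (k : ℕ) : ℤ × ℤ :=
  ∑ i ∈ Finset.range k,
    (disp ((D.facePerm ^ i) e) - disp (D.black⁻¹ ((D.facePerm ^ i) e)))

/-- Twice the signed area (by the shoelace formula) of the closed polygon in the plane which
is the lift of the boundary of the face to the left of `e`.  Its consecutive vertices are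
`P₀, P₀ + d₀, P₁, P₁ + d₁, …`, where `Pₖ = facePos k` are the positions of white nodes and
`dₖ = disp (facePerm ^ k e)`. -/
def faceArea₂ (disp : E → ℤ × ℤ) (e : E) : ℤ :=
  ∑ k ∈ Finset.range (Function.minimalPeriod D.facePerm e),
    (wedge (D.facePos disp e k) (D.facePos disp e k + disp ((D.facePerm ^ k) e)) +
     wedge (D.facePos disp e k + disp ((D.facePerm ^ k) e)) (D.facePos disp e (k + 1)))

open Classical in
/-- An identification (up to homotopy) of the surface of the map with the oriented torus `ℝ² / ℤ²`.

Choose a lift to the plane of every node.  An edge that starts at the chosen lift of its white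
endpoint then ends at a translate of the chosen lift of its black endpoint by a vector
`disp e ∈ ℤ²`, so that the winding number of a closed path is the signed sum of `disp` over its
edges.  The boundary of every face lifts to a closed path, and `disp` induces an isomorphism from
the first homology group (cycles modulo boundaries) onto `ℤ²`, the first homology group
of the torus.  The identification has degree one: the faces, developed into the
plane, cover the torus exactly once with positive orientation, so that their signed areas add up to
`1`, the area of the torus.  (In other words, the cup product of the two components of `disp`
has the value `1` on the fundamental class.  The sum does not depend on the lifts nor on the
starting points of the faces.) -/
structure TorusMarking [Fintype E] where
  disp : E → ℤ × ℤ
  face_closed : ∀ f : D.Face, ∑ e with D.leftFace e = f, (disp e - disp (D.black⁻¹ e)) = 0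
  homology_injective : ∀ z : E → ℤ, D.IsCycle z → ∑ e, z e • disp e = 0 → D.IsBoundary z
  homology_surjective : ∀ w : ℤ × ℤ, ∃ z : E → ℤ, D.IsCycle z ∧ ∑ e, z e • disp e = w
  degree_one : ∑ f : D.Face, D.faceArea₂ disp f.out = 2

variable {D} [Fintype E]

open Classical in
/-- The winding number of a zigzag path: it traverses the edges `e` of its cycle from black to white
and the edges `white e` from white to black. -/
def TorusMarking.winding (T : D.TorusMarking) (Z : D.Zigzag) : ℤ × ℤ :=
  ∑ e with D.zigzagOf e = Z, (T.disp (D.white e) - T.disp e)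

end BipartiteMap

/-- The argument in `(-π, π]` of an integer vector. -/
def vecArg (w : ℤ × ℤ) : ℝ := Complex.arg ⟨(w.1 : ℝ), (w.2 : ℝ)⟩

/-- The direction of a nonzero integer vector, as a point of the circle `ℝ / 2πℤ` (with its
counterclockwise circular order). -/
def vecDir (w : ℤ × ℤ) : Real.Angle := (vecArg w : Real.Angle)

namespace BipartiteMap

variable {E : Type*} [Fintype E] {D : BipartiteMap E}

/-- `rot` is `white` or `black`.  In both cases the zigzag paths in counterclockwise order around the
node at the end of `e` are `zigzagOf e, zigzagOf (rot e), zigzagOf (rot² e), …`, one for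
every corner.  The node is properly ordered if no such path has winding zero, no two of them that
intersect on an edge at the node have windings in the same direction, and their order
is the circular order of the directions of their windings. -/
def TorusMarking.OrderedAt (T : D.TorusMarking) (rot : Equiv.Perm E) (e : E) : Prop :=
  (∀ e', rot.SameCycle e e' → T.winding (D.zigzagOf e') ≠ 0) ∧
  (∀ e', rot.SameCycle e e' →
    vecDir (T.winding (D.zigzagOf e')) ≠ vecDir (T.winding (D.zigzagOf (rot e')))) ∧
  (∀ e', rot.SameCycle e e' → ∀ i j : ℕ, 0 < i → i < j → j < Function.minimalPeriod rot e' →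
    sbtw (vecDir (T.winding (D.zigzagOf e')))
      (vecDir (T.winding (D.zigzagOf ((rot ^ i) e'))))
      (vecDir (T.winding (D.zigzagOf ((rot ^ j) e')))))

/-- A node is properly ordered if the zigzag paths around it are. -/
def TorusMarking.NodeProperlyOrdered (T : D.TorusMarking) : D.Node → Prop
  | Sum.inl w => ∀ e, D.whiteEnd e = w → T.OrderedAt D.white e
  | Sum.inr b => ∀ e, D.blackEnd e = b → T.OrderedAt D.black e

/-- A dimer is properly ordered if all its nodes are. -/
def TorusMarking.ProperlyOrdered (T : D.TorusMarking) : Prop :=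
  ∀ v : D.Node, T.NodeProperlyOrdered v

end BipartiteMap

open Classical in
/-- The convex polygon whose `(p, q)`-legs are the vectors `w i` (with sum zero).  Its sides are the
vectors `w i`, rotated by 90 degrees counterclockwise and laid tip to tail in the order of their
arguments, so that `w i` is an outward normal, of the same length, of its side (vectors
in the same direction are pieces of a single side, and zero vectors contribute nothing).  Its
vertices are therefore the sums of the sides with argument of `w i` at most `θ`. -/
def legPolygon {ι : Type*} [Fintype ι] (w : ι → ℤ × ℤ) : Set (ℝ × ℝ) :=
  convexHull ℝ {p | ∃ θ : ℝ, p = ∑ i with vecArg (w i) ≤ θ, (-((w i).2 : ℝ), ((w i).1 : ℝ))}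

open Classical in
/-- The area of the polygon whose `(p, q)`-legs are the winding numbers of the zigzag paths. -/
def BipartiteMap.TorusMarking.zigzagArea {E : Type*} [Fintype E] {D : BipartiteMap E}
    (T : D.TorusMarking) : ℝ :=
  (volume (legPolygon T.winding)).toReal

end

/-! Give every zigzag path `Z` the argument `θ Z` of its winding in (-π, π], and every edge the sign
(1, -1 or 0) of the change of `θ` between the two paths that cross on it. Cutting `P` into a fan of
triangles at one vertex shows that twice its area is the sum of `wedge (T.winding Z') (T.winding Z)`
over the pairs with `θ Z' < θ Z` (`volume_legPolygon`). By Poincaré duality each wedge is a signed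
number of crossings (`sum_crossings`), so twice the area is the sum S of the signs of all edges.

Around a node of valence n ≥ 2 the values of `θ` are either constant or descend somewhere, so the
signs there add up to at most n - 2 (`sum_stepSign_le`). Equality means a single descent and
otherwise ascents, which is the proper order, or else n = 2 and constant `θ`. With E edges, W white
and B black nodes and F faces, summing over the white nodes gives S ≤ E - 2W, and summing over the
black nodes gives S ≤ E - 2B, because an edge has the same sign at both ends. The mean of the two
bounds is F by Euler's formula (`card_edge_eq`). Hence S = F exactly when every node is extremal.

It remains to exclude vanishing signs when S = F. In an extremal dimer a zero sign spreads around
nodes, hence by connectedness to all edges, so that S = 0 < F (`position_ne_of_numFaces_eq`). A path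
of winding zero does not affect the area, so its position `θ` is free; putting it at the position of
a path that it crosses produces a zero sign (`winding_ne_zero_of_numFaces_eq`). -/

noncomputable section

/-! ### Areas of triangles and null sets in the plane. -/

/-- The determinant of two vectors of the real plane. -/
def planeDet (u v : ℝ × ℝ) : ℝ := u.1 * v.2 - u.2 * v.1

/-- The linear map that sends the standard basis of the plane to `u, v`. -/
def planeMap (u v : ℝ × ℝ) : (ℝ × ℝ) →ₗ[ℝ] (ℝ × ℝ) :=
  (LinearMap.fst ℝ ℝ ℝ).smulRight u + (LinearMap.snd ℝ ℝ ℝ).smulRight v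

theorem planeMap_apply (u v p : ℝ × ℝ) : planeMap u v p = p.1 • u + p.2 • v := rfl

theorem det_planeMap (u v : ℝ × ℝ) : LinearMap.det (planeMap u v) = planeDet u v := by
  rw [← LinearMap.det_toMatrix (Module.Basis.finTwoProd ℝ), Matrix.det_fin_two]
  simp [LinearMap.toMatrix_apply, planeMap_apply, planeDet]
  ring

/-- The triangle with vertices `(0, 0)`, `(1, 0)`, `(0, 1)`. -/
def stdTriangle : Set (ℝ × ℝ) := {p | 0 ≤ p.1 ∧ 0 ≤ p.2 ∧ p.1 + p.2 ≤ 1}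

theorem measurableSet_stdTriangle : MeasurableSet stdTriangle :=
  ((isClosed_le continuous_const continuous_fst).inter
    ((isClosed_le continuous_const continuous_snd).inter
      (isClosed_le (continuous_fst.add continuous_snd) continuous_const))).measurableSet

theorem volume_stdTriangle : volume stdTriangle = ENNReal.ofReal (1 / 2) := by
  have hslice : ∀ x : ℝ, volume (Prod.mk x ⁻¹' stdTriangle) =
      (Set.Icc (0 : ℝ) 1).indicator (fun x => ENNReal.ofReal (1 - x)) x := by
    intro x
    by_cases hx : x ∈ Set.Icc (0 : ℝ) 1
    · have : Prod.mk x ⁻¹' stdTriangle = Set.Icc 0 (1 - x) := by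
        ext y
        simp only [stdTriangle, Set.mem_preimage, Set.mem_ofPred_eq, Set.mem_Icc]
        exact ⟨fun h => ⟨h.2.1, by linarith [h.2.2]⟩, fun h => ⟨hx.1, h.1, by linarith [h.2]⟩⟩
      rw [this, Real.volume_Icc, Set.indicator_of_mem hx, sub_zero]
    · have : Prod.mk x ⁻¹' stdTriangle = ∅ := by
        ext y
        simp only [stdTriangle, Set.mem_preimage, Set.mem_ofPred_eq, Set.mem_empty_iff_false,
          iff_false]
        exact fun h => hx ⟨h.1, by linarith [h.2.2, h.2.1]⟩
      rw [this, Set.indicator_of_notMem hx, measure_empty]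
  rw [Measure.volume_eq_prod, Measure.prod_apply measurableSet_stdTriangle]
  simp_rw [hslice]
  rw [lintegral_indicator measurableSet_Icc, ← ofReal_integral_eq_lintegral_ofReal]
  · rw [integral_Icc_eq_integral_Ioc, ← intervalIntegral.integral_of_le zero_le_one]
    congr 1
    rw [intervalIntegral.integral_sub (by simp) (by simp)]
    simp
    norm_num
  · exact (continuous_const.sub continuous_id).integrableOn_Icc
  · filter_upwards [ae_restrict_mem measurableSet_Icc] with x hx
    simpa using hx.2

theorem volume_image_stdTriangle (u v : ℝ × ℝ) :
    volume (planeMap u v '' stdTriangle) = ENNReal.ofReal (|planeDet u v| / 2) := by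
  rw [Measure.addHaar_image_linearMap, det_planeMap, volume_stdTriangle,
    ← ENNReal.ofReal_mul (abs_nonneg _)]
  congr 1
  ring

theorem volume_line_eq_zero {u : ℝ × ℝ} (hu : u ≠ 0) :
    volume {x : ℝ × ℝ | planeDet x u = 0} = 0 := by
  let f : (ℝ × ℝ) →ₗ[ℝ] ℝ := u.2 • LinearMap.fst ℝ ℝ ℝ - u.1 • LinearMap.snd ℝ ℝ ℝ
  have hf : ∀ x, f x = planeDet x u := fun x => by
    simp [f, planeDet]
    ring
  have hset : {x : ℝ × ℝ | planeDet x u = 0} = (LinearMap.ker f : Set (ℝ × ℝ)) := by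
    ext x
    simp [hf]
  rw [hset]
  apply Measure.addHaar_submodule
  intro htop
  -- At `u` turned by 90 degrees the functional takes the value -|u|², so it is not zero.
  have h1 : f (-u.2, u.1) = 0 := by
    rw [← LinearMap.mem_ker, htop]
    trivial
  rw [hf] at h1
  apply hu
  simp only [planeDet] at h1
  ext <;> simp <;> nlinarith [sq_nonneg u.1, sq_nonneg u.2]

/-! ### Growing a convex hull by one vertex. -/

/-- An affine inequality that holds on a set holds on its convex hull. -/
theorem convexHull_affine_nonneg {X : Set (ℝ × ℝ)} {a b c : ℝ}
    (h : ∀ x ∈ X, 0 ≤ a * x.1 + b * x.2 + c) :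
    ∀ x ∈ convexHull ℝ X, 0 ≤ a * x.1 + b * x.2 + c := by
  have hconv : Convex ℝ {x : ℝ × ℝ | 0 ≤ a * x.1 + b * x.2 + c} := by
    intro x hx y hy s t hs ht hst
    simp only [Set.mem_ofPred_eq, Prod.fst_add, Prod.smul_fst, smul_eq_mul, Prod.snd_add,
      Prod.smul_snd] at *
    have hc : c = s * c + t * c := by rw [← add_mul, hst, one_mul]
    nlinarith [mul_nonneg hs hx, mul_nonneg ht hy]
  exact fun x hx => convexHull_min h hconv hx

theorem convexHull_volume_eq_zero_of_subset_line {X : Set (ℝ × ℝ)} {u : ℝ × ℝ} (hu : u ≠ 0)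
    (h : ∀ x ∈ X, planeDet x u = 0) : volume (convexHull ℝ X) = 0 := by
  refine measure_mono_null (fun x hx => ?_) (volume_line_eq_zero hu)
  have h₁ := convexHull_affine_nonneg (a := u.2) (b := -u.1) (c := 0)
    (fun x hx => by have := h x hx; simp only [planeDet] at this; linarith) x hx
  have h₂ := convexHull_affine_nonneg (a := -u.2) (b := u.1) (c := 0)
    (fun x hx => by have := h x hx; simp only [planeDet] at this; linarith) x hx
  simp only [Set.mem_ofPred_eq, planeDet]
  linarith

/-- Cramer's rule. -/
theorem planeDet_decomp {q r : ℝ × ℝ} (h : planeDet q r ≠ 0) (x : ℝ × ℝ) :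
    x = (planeDet x r / planeDet q r) • q + (planeDet q x / planeDet q r) • r := by
  have h' : q.1 * r.2 - q.2 * r.1 ≠ 0 := h
  ext <;> simp only [planeDet, Prod.fst_add, Prod.smul_fst, smul_eq_mul, Prod.snd_add,
      Prod.smul_snd] <;>
    rw [div_mul_eq_mul_div, div_mul_eq_mul_div, ← add_div, eq_div_iff h'] <;> ring

theorem exists_smul_of_planeDet_eq_zero {q r : ℝ × ℝ} (hq : q ≠ 0) (h : planeDet q r = 0) :
    ∃ t : ℝ, r = t • q := by
  simp only [planeDet] at h
  by_cases h1 : q.1 = 0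
  · have h2 : q.2 ≠ 0 := fun h2 => hq (Prod.ext h1 h2)
    have h3 : r.1 = 0 := by
      have : q.2 * r.1 = 0 := by rw [h1] at h; linarith
      exact (mul_eq_zero.1 this).resolve_left h2
    refine ⟨r.2 / q.2, Prod.ext ?_ ?_⟩
    · simp [h1, h3]
    · simp [h2]
  · refine ⟨r.1 / q.1, Prod.ext ?_ ?_⟩
    · simp [h1]
    · simp only [Prod.smul_snd, smul_eq_mul]
      field_simp
      linarith

/-- Attaching the vertex `r` along the edge from `0` to `q` of the convex hull of `X`. -/
theorem convexHull_insert_eq_union {X : Set (ℝ × ℝ)} {q r : ℝ × ℝ} (h0 : 0 ∈ X) (hq : q ∈ X)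
    (hqr : 0 < planeDet q r) (h1 : ∀ x ∈ X, 0 ≤ planeDet x r)
    (h2 : ∀ x ∈ X, 0 ≤ planeDet (q - x) (r - q)) (h3 : ∀ x ∈ X, 0 ≤ planeDet x q) :
    convexHull ℝ (insert r X) = convexHull ℝ X ∪ planeMap q r '' stdTriangle := by
  have h1' := convexHull_affine_nonneg (X := X) (a := r.2) (b := -r.1) (c := 0)
    (fun x hx => by have := h1 x hx; simp only [planeDet] at this; linarith)
  have h3' := convexHull_affine_nonneg (X := X) (a := q.2) (b := -q.1) (c := 0)
    (fun x hx => by have := h3 x hx; simp only [planeDet] at this; linarith)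
  have h2' := convexHull_affine_nonneg (X := X) (a := -(r.2 - q.2)) (b := r.1 - q.1)
    (c := planeDet q r)
    (fun x hx => by
      have := h2 x hx
      simp only [planeDet, Prod.fst_sub, Prod.snd_sub] at this ⊢
      linarith)
  have hconv := convex_convexHull ℝ (insert r X)
  have hX : convexHull ℝ X ⊆ convexHull ℝ (insert r X) := convexHull_mono (Set.subset_insert r X)
  have h0' := subset_convexHull ℝ X h0
  have hq' := subset_convexHull ℝ X hq
  apply Set.Subset.antisymm
  · rw [convexHull_insert ⟨0, h0⟩]
    intro y hy
    rw [mem_convexJoin] at hy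
    obtain ⟨r', hr', x, hx, hy⟩ := hy
    rw [Set.mem_singleton_iff] at hr'
    subst hr'
    obtain ⟨s, t, hs, ht, hst, rfl⟩ := hy
    -- In the basis `q, r'` the hull of `X` satisfies `0 ≤ α`, `β ≤ 0` and `α + β ≤ 1`. A point of
    -- the segment from `r'` to `x` has coordinates `(t * α, t * β + s)`; the sign of the second one
    -- decides whether it lies in the new triangle or in the old hull.
    set c := planeDet q r' with hc
    set α := planeDet x r' / c with hα
    set β := planeDet q x / c with hβ
    have hxd : x = α • q + β • r' := planeDet_decomp hqr.ne' x
    have hα0 : 0 ≤ α := div_nonneg (by have := h1' x hx; simp only [planeDet]; linarith) hqr.le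
    have hβ0 : β ≤ 0 := div_nonpos_of_nonpos_of_nonneg
      (by have := h3' x hx; simp only [planeDet]; linarith) hqr.le
    have hαβ : α + β ≤ 1 := by
      rw [hα, hβ, ← add_div, div_le_one hqr]
      have := h2' x hx
      rw [hc] at *
      simp only [planeDet] at *
      linarith
    by_cases hb : 0 ≤ t * β + s
    · right
      refine ⟨(t * α, t * β + s), ⟨by positivity, hb, ?_⟩, ?_⟩
      · have : t * (α + β) ≤ t := by nlinarith
        simp only
        linarith
      · rw [planeMap_apply]
        conv_rhs => rw [hxd]
        simp only
        module
    · left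
      push Not at hb
      have hβ1 : β < 0 := by
        rcases hβ0.lt_or_eq with h | h
        · exact h
        · rw [h] at hb; linarith
      -- the point where the segment from `x` to `r'` meets the line through `0` and `q`
      have hd : 0 < 1 - β := by linarith
      have hz : (α / (1 - β)) • q ∈ convexHull ℝ X := by
        have : (α / (1 - β)) • q = (1 - α / (1 - β)) • (0 : ℝ × ℝ) + (α / (1 - β)) • q := by simp
        rw [this]
        exact convex_convexHull ℝ X h0' hq'
          (by rw [sub_nonneg, div_le_one hd]; linarith) (by positivity) (by ring)
      have hs' : s * (1 - β) ≤ -β := by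
        have : t = 1 - s := by linarith
        rw [this] at hb
        linarith
      have hk : s * (1 - β) / (-β) ≤ 1 := by
        rw [div_le_one (by linarith)]
        exact hs'
      have hfin : s • r' + t • x =
          (s * (1 - β) / (-β)) • ((α / (1 - β)) • q) + (1 - s * (1 - β) / (-β)) • x := by
        have ht' : t = 1 - s := by linarith
        rw [hxd, ht']
        have e1 : s * (1 - β) / (-β) * (α / (1 - β)) = s * α / (-β) := by
          field_simp
        rw [smul_smul, e1]
        have hβne : β ≠ 0 := hβ1.ne
        ext <;> simp only [Prod.fst_add, Prod.smul_fst, smul_eq_mul, Prod.snd_add,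
          Prod.smul_snd] <;> field_simp <;> ring
      rw [hfin]
      exact convex_convexHull ℝ X hz hx
        (div_nonneg (mul_nonneg hs hd.le) (by linarith)) (by linarith) (by ring)
  · apply Set.union_subset hX
    rintro _ ⟨p, ⟨hp1, hp2, hp3⟩, rfl⟩
    have hr : r ∈ convexHull ℝ (insert r X) := subset_convexHull ℝ _ (Set.mem_insert r X)
    rw [planeMap_apply]
    have := hconv.sum_mem (t := Finset.univ) (w := ![1 - p.1 - p.2, p.1, p.2]) (z := ![0, q, r])
      (by intro i _; fin_cases i <;> simp <;> linarith)
      (by simp only [Fin.sum_univ_three, Matrix.cons_val]; ring)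
      (by intro i _; fin_cases i <;> simp [hr, hX h0', hX hq'])
    simpa [Fin.sum_univ_three] using this

/-- The new triangle meets the old hull only in the line through `0` and `q`, a null set. If
`planeDet q r = 0`, no area is gained: either everything lies on one line, or the sign conditions
force `r` into the segment from `0` to `q`. -/
theorem volume_convexHull_insert {X : Set (ℝ × ℝ)} {q r : ℝ × ℝ} (h0 : 0 ∈ X) (hq : q ∈ X)
    (h1 : ∀ x ∈ X, 0 ≤ planeDet x r)
    (h2 : ∀ x ∈ X, 0 ≤ planeDet (q - x) (r - q)) (h3 : ∀ x ∈ X, 0 ≤ planeDet x q) :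
    volume (convexHull ℝ (insert r X)) =
      volume (convexHull ℝ X) + ENNReal.ofReal (planeDet q r / 2) := by
  rcases (h1 q hq).lt_or_eq with hqr | hqr
  · rw [convexHull_insert_eq_union h0 hq hqr h1 h2 h3, measure_union₀', volume_image_stdTriangle,
      abs_of_pos hqr]
    · exact (convex_convexHull ℝ X).nullMeasurableSet _
    · have hq0 : q ≠ 0 := by
        rintro rfl
        simp [planeDet] at hqr
      refine measure_mono_null ?_ (volume_line_eq_zero hq0)
      rintro _ ⟨hx, p, ⟨hp1, hp2, hp3⟩, rfl⟩
      have h3' := convexHull_affine_nonneg (X := X) (a := q.2) (b := -q.1) (c := 0)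
        (fun x hx => by have := h3 x hx; simp only [planeDet] at this; linarith) _ hx
      have hp : planeDet (planeMap q r p) q = - (p.2 * planeDet q r) := by
        simp only [planeMap_apply, planeDet, Prod.fst_add, Prod.smul_fst, smul_eq_mul,
          Prod.snd_add, Prod.smul_snd]
        ring
      have hp' : 0 ≤ planeDet (planeMap q r p) q := by
        simp only [planeDet]
        linarith
      simp only [Set.mem_ofPred_eq]
      have := mul_nonneg hp2 hqr.le
      linarith
  · rw [← hqr, zero_div, ENNReal.ofReal_zero, add_zero]
    by_cases hq0 : q = 0
    · subst hq0
      by_cases hr0 : r = 0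
      · rw [hr0, Set.insert_eq_of_mem h0]
      · have hX : ∀ x ∈ X, planeDet x r = 0 := fun x hx => by
          have a := h1 x hx
          have b := h2 x hx
          simp only [planeDet, Prod.fst_sub, Prod.snd_sub, Prod.fst_zero, Prod.snd_zero] at *
          linarith
        rw [convexHull_volume_eq_zero_of_subset_line hr0 hX,
          convexHull_volume_eq_zero_of_subset_line hr0]
        rintro x (rfl | hx)
        · simp only [planeDet]; ring
        · exact hX x hx
    · obtain ⟨t, rfl⟩ := exists_smul_of_planeDet_eq_zero hq0 hqr.symm
      by_cases hX : ∀ x ∈ X, planeDet x q = 0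
      · rw [convexHull_volume_eq_zero_of_subset_line hq0 hX,
          convexHull_volume_eq_zero_of_subset_line hq0]
        rintro x (rfl | hx)
        · simp only [planeDet, Prod.smul_fst, Prod.smul_snd, smul_eq_mul]; ring
        · exact hX x hx
      · push Not at hX
        obtain ⟨x, hx, hx0⟩ := hX
        have hpos : 0 < planeDet x q := lt_of_le_of_ne (h3 x hx) hx0.symm
        have ht0 : 0 ≤ t * planeDet x q := by
          have := h1 x hx
          simp only [planeDet, Prod.smul_fst, Prod.smul_snd, smul_eq_mul] at *
          linarith
        have ht1 : 0 ≤ (1 - t) * planeDet x q := by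
          have := h2 x hx
          simp only [planeDet, Prod.smul_fst, Prod.smul_snd, smul_eq_mul, Prod.fst_sub,
            Prod.snd_sub] at *
          linarith
        have ht0' : 0 ≤ t := nonneg_of_mul_nonneg_left ht0 hpos
        have ht1' : 0 ≤ 1 - t := nonneg_of_mul_nonneg_left ht1 hpos
        have hr : t • q ∈ convexHull ℝ X := by
          have : t • q = (1 - t) • (0 : ℝ × ℝ) + t • q := by simp
          rw [this]
          exact convex_convexHull ℝ X (subset_convexHull ℝ X h0) (subset_convexHull ℝ X hq)
            ht1' ht0' (by ring)
        congr 1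
        apply Set.Subset.antisymm
        · exact convexHull_min (Set.insert_subset hr (subset_convexHull ℝ X))
            (convex_convexHull ℝ X)
        · exact convexHull_mono (Set.subset_insert _ X)

/-! ### Polygon sides in polar form, and signs of sines. -/

/-- The vector of length `ρ` with direction `θ + π / 2`. -/
def polarNormal (ρ θ : ℝ) : ℝ × ℝ := (-(ρ * Real.sin θ), ρ * Real.cos θ)

theorem planeDet_polarNormal (ρ θ R φ : ℝ) :
    planeDet (polarNormal ρ θ) (polarNormal R φ) = ρ * R * Real.sin (φ - θ) := by
  rw [Real.sin_sub]
  simp only [planeDet, polarNormal]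
  ring

theorem exists_eq_polarNormal (u : ℝ × ℝ) : ∃ R φ : ℝ, 0 ≤ R ∧ u = polarNormal R φ := by
  refine ⟨‖(⟨u.2, -u.1⟩ : ℂ)‖, Complex.arg ⟨u.2, -u.1⟩, norm_nonneg _, ?_⟩
  have h1 := Complex.norm_mul_cos_arg ⟨u.2, -u.1⟩
  have h2 := Complex.norm_mul_sin_arg ⟨u.2, -u.1⟩
  simp only at h1 h2
  simp only [polarNormal, h1, h2, neg_neg]

theorem planeDet_add_right (u v w : ℝ × ℝ) : planeDet u (v + w) = planeDet u v + planeDet u w := by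
  simp only [planeDet, Prod.fst_add, Prod.snd_add]; ring

theorem planeDet_swap (u v : ℝ × ℝ) : planeDet u v = -planeDet v u := by
  simp only [planeDet]; ring

theorem planeDet_self (u : ℝ × ℝ) : planeDet u u = 0 := by
  simp only [planeDet]; ring

theorem planeDet_sum_left {ι : Type*} (s : Finset ι) (v : ι → ℝ × ℝ) (w : ℝ × ℝ) :
    planeDet (∑ i ∈ s, v i) w = ∑ i ∈ s, planeDet (v i) w := by
  simp only [planeDet, Prod.fst_sum, Prod.snd_sum, Finset.sum_mul, Finset.sum_sub_distrib]

theorem planeDet_sum_right {ι : Type*} (s : Finset ι) (w : ℝ × ℝ) (v : ι → ℝ × ℝ) :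
    planeDet w (∑ i ∈ s, v i) = ∑ i ∈ s, planeDet w (v i) := by
  simp only [planeDet, Prod.fst_sum, Prod.snd_sum, Finset.mul_sum, Finset.sum_sub_distrib]

theorem pi_lt_of_sin_neg {x : ℝ} (h0 : 0 ≤ x) (h : Real.sin x < 0) : Real.pi < x := by
  by_contra hx
  exact absurd (Real.sin_nonneg_of_nonneg_of_le_pi h0 (not_lt.1 hx)) (not_le.2 h)

theorem sin_neg_of_pi_lt {x : ℝ} (h0 : Real.pi < x) (h : x < 2 * Real.pi) : Real.sin x < 0 := by
  rw [← Real.sin_sub_two_pi]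
  exact Real.sin_neg_of_neg_of_neg_pi_lt (by linarith) (by linarith)

/-- The function `x ↦ sin (φ - x)` cannot have the signs `≥ 0`, `< 0`, `> 0`, `≤ 0` in this order
within less than a full turn. -/
theorem not_four_sign_alternations {φ x₁ x₂ x₃ x₄ : ℝ} (h₁₂ : x₁ < x₂) (h₂₃ : x₂ < x₃)
    (h₃₄ : x₃ < x₄) (h₄ : x₄ < x₁ + 2 * Real.pi) (s₁ : 0 ≤ Real.sin (φ - x₁))
    (s₂ : Real.sin (φ - x₂) < 0) (s₃ : 0 < Real.sin (φ - x₃)) (s₄ : Real.sin (φ - x₄) ≤ 0) :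
    False := by
  have hp : 0 < 2 * Real.pi := by positivity
  -- Shift `φ` by full turns to `ψ` so that `x₂ - ψ` lies in [0, 2π). The signs then force `x₂ - ψ <
  -- π`, `x₃ - ψ > π` and `x₄ - ψ ≥ 2π`; hence `x₁ - ψ` lies in (0, π), where the sine has the wrong
  -- sign.
  obtain ⟨ψ, hψ, hψ0, hψ1⟩ : ∃ ψ, (∀ x, Real.sin (φ - x) = -Real.sin (x - ψ)) ∧
      0 ≤ x₂ - ψ ∧ x₂ - ψ < 2 * Real.pi := by
    have hm := toIcoMod_mem_Ico hp 0 (x₂ - φ)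
    have he := toIcoMod_add_toIcoDiv_zsmul hp 0 (x₂ - φ)
    set n := toIcoDiv hp 0 (x₂ - φ)
    set m := toIcoMod hp 0 (x₂ - φ)
    rw [zsmul_eq_mul] at he
    refine ⟨φ + n * (2 * Real.pi), fun x => ?_, ?_, ?_⟩
    · have : x - (φ + n * (2 * Real.pi)) = -(φ - x) - n * (2 * Real.pi) := by ring
      rw [this, Real.sin_sub_int_mul_two_pi, Real.sin_neg, neg_neg]
    · linarith [hm.1]
    · linarith [hm.2]
  rw [hψ] at s₁ s₂ s₃ s₄
  have h2 : x₂ - ψ < Real.pi := by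
    by_contra h
    rcases (not_lt.1 h).lt_or_eq with h | h
    · linarith [sin_neg_of_pi_lt h hψ1]
    · rw [← h, Real.sin_pi] at s₂
      linarith
  have h3 : Real.pi < x₃ - ψ := pi_lt_of_sin_neg (by linarith) (by linarith)
  have h4 : 2 * Real.pi ≤ x₄ - ψ := by
    by_contra h
    linarith [sin_neg_of_pi_lt (x := x₄ - ψ) (by linarith) (not_le.1 h)]
  linarith [Real.sin_pos_of_pos_of_lt_pi (x := x₁ - ψ) (by linarith) (by linarith)]

theorem exists_neg_of_planeDet_sum_neg {ι : Type*} {s : Finset ι} {v : ι → ℝ × ℝ} {u : ℝ × ℝ}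
    (h : planeDet u (∑ i ∈ s, v i) < 0) : ∃ i ∈ s, planeDet u (v i) < 0 := by
  rw [planeDet_sum_right] at h
  by_contra hc
  push Not at hc
  exact absurd (Finset.sum_nonneg hc) (not_le.2 h)

/-! ### The polygon with given sides: convexity and area. -/

section Fan

variable {ι : Type*} [Fintype ι] {ρ θ : ι → ℝ}

open Classical in
/-- The sum of the sides whose normal direction lies in `(r, t]`. -/
def sideSum (ρ θ : ι → ℝ) (r t : ℝ) : ℝ × ℝ :=
  ∑ i with r < θ i ∧ θ i ≤ t, polarNormal (ρ i) (θ i)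

theorem planeDet_sum_eq_neg_compl (hsum : ∑ i, polarNormal (ρ i) (θ i) = 0) (u : ℝ × ℝ)
    (s : Finset ι) [DecidableEq ι] : planeDet u (∑ i ∈ s, polarNormal (ρ i) (θ i)) =
      - planeDet u (∑ i ∈ sᶜ, polarNormal (ρ i) (θ i)) := by
  have := congrArg (planeDet u) hsum
  rw [← Finset.sum_add_sum_compl s, planeDet_add_right] at this
  have h0 : planeDet u 0 = 0 := by simp [planeDet]
  linarith

/-- Otherwise some side `a` of the arc lies more than π beyond the first side `m`. As all sides add
up to zero, some side `c` outside the arc lies strictly to the left of `m`. If `c` comes after the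
arc, it is also more than π beyond `m`; if before, it is more than a full turn behind `a`. Both are
impossible. -/
theorem planeDet_first_sideSum_nonneg (hρ : ∀ i, 0 ≤ ρ i)
    (hθ : ∀ i j, θ i < θ j + 2 * Real.pi) (hsum : ∑ i, polarNormal (ρ i) (θ i) = 0) {r t : ℝ}
    {m : ι} (hm : r < θ m ∧ θ m ≤ t)
    (hmin : ∀ i, r < θ i → θ i ≤ t → ρ i ≠ 0 → θ m ≤ θ i) :
    0 ≤ planeDet (polarNormal (ρ m) (θ m)) (sideSum ρ θ r t) := by
  classical
  by_contra hneg
  push Not at hneg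
  have hneg' := hneg
  unfold sideSum at hneg hneg'
  obtain ⟨a, ha, hna⟩ := exists_neg_of_planeDet_sum_neg hneg
  rw [planeDet_sum_eq_neg_compl hsum] at hneg'
  have : ∃ c ∈ (Finset.univ.filter fun i => r < θ i ∧ θ i ≤ t)ᶜ,
      0 < planeDet (polarNormal (ρ m) (θ m)) (polarNormal (ρ c) (θ c)) := by
    by_contra hc
    push Not at hc
    rw [planeDet_sum_right] at hneg'
    linarith [Finset.sum_nonpos hc]
  obtain ⟨c, hc, hpc⟩ := this
  simp only [Finset.mem_compl, Finset.mem_filter, Finset.mem_univ, true_and] at ha hc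
  rw [planeDet_polarNormal] at hna hpc
  have ha0 : ρ a ≠ 0 := by rintro h; simp [h] at hna
  have hsa : Real.sin (θ a - θ m) < 0 := by
    by_contra h
    linarith [mul_nonneg (mul_nonneg (hρ m) (hρ a)) (not_lt.1 h)]
  have hsc : 0 < Real.sin (θ c - θ m) := by
    by_contra h
    linarith [mul_nonpos_of_nonneg_of_nonpos (mul_nonneg (hρ m) (hρ c)) (not_lt.1 h)]
  have h1 := hmin a ha.1 ha.2 ha0
  have h2 : Real.pi < θ a - θ m := pi_lt_of_sin_neg (by linarith) hsa
  by_cases hcr : r < θ c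
  · have hct : t < θ c := by
      by_contra h
      exact hc ⟨hcr, not_lt.1 h⟩
    linarith [sin_neg_of_pi_lt (x := θ c - θ m) (by linarith) (by linarith [hθ c m])]
  · have h3 : Real.pi < θ m - θ c :=
      pi_lt_of_sin_neg (by linarith) (by rw [← neg_sub, Real.sin_neg]; linarith)
    linarith [hθ a c]

/-- The mirror image of `planeDet_first_sideSum_nonneg`. -/
theorem planeDet_last_sideSum_nonpos (hρ : ∀ i, 0 ≤ ρ i)
    (hθ : ∀ i j, θ i < θ j + 2 * Real.pi) (hsum : ∑ i, polarNormal (ρ i) (θ i) = 0) {r t : ℝ}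
    {m : ι} (hm : r < θ m ∧ θ m ≤ t)
    (hmax : ∀ i, r < θ i → θ i ≤ t → ρ i ≠ 0 → θ i ≤ θ m) :
    planeDet (polarNormal (ρ m) (θ m)) (sideSum ρ θ r t) ≤ 0 := by
  classical
  by_contra hpos
  push Not at hpos
  have hpos' := hpos
  unfold sideSum at hpos hpos'
  rw [planeDet_sum_eq_neg_compl hsum] at hpos'
  obtain ⟨c, hc, hnc⟩ := exists_neg_of_planeDet_sum_neg (neg_pos.1 hpos')
  have : ∃ a ∈ (Finset.univ.filter fun i => r < θ i ∧ θ i ≤ t),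
      0 < planeDet (polarNormal (ρ m) (θ m)) (polarNormal (ρ a) (θ a)) := by
    by_contra hc
    push Not at hc
    rw [planeDet_sum_right] at hpos
    linarith [Finset.sum_nonpos hc]
  obtain ⟨a, ha, hpa⟩ := this
  simp only [Finset.mem_compl, Finset.mem_filter, Finset.mem_univ, true_and] at ha hc
  rw [planeDet_polarNormal] at hpa hnc
  have ha0 : ρ a ≠ 0 := by rintro h; simp [h] at hpa
  have hsa : 0 < Real.sin (θ a - θ m) := by
    by_contra h
    linarith [mul_nonpos_of_nonneg_of_nonpos (mul_nonneg (hρ m) (hρ a)) (not_lt.1 h)]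
  have hsc : Real.sin (θ c - θ m) < 0 := by
    by_contra h
    linarith [mul_nonneg (mul_nonneg (hρ m) (hρ c)) (not_lt.1 h)]
  have h1 := hmax a ha.1 ha.2 ha0
  have h2 : Real.pi < θ m - θ a :=
    pi_lt_of_sin_neg (by linarith) (by rw [← neg_sub, Real.sin_neg]; linarith)
  by_cases hcr : r < θ c
  · have hct : t < θ c := by
      by_contra h
      exact hc ⟨hcr, not_lt.1 h⟩
    have h3 : Real.pi < θ c - θ m := pi_lt_of_sin_neg (by linarith) hsc
    linarith [hθ c a]
  · have := sin_neg_of_pi_lt (x := θ m - θ c) (by linarith) (by linarith [hθ m c])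
    rw [← neg_sub, Real.sin_neg] at this
    linarith

theorem sideSum_add {r s t : ℝ} (hrs : r ≤ s) (hst : s ≤ t) :
    sideSum ρ θ r t = sideSum ρ θ r s + sideSum ρ θ s t := by
  classical
  unfold sideSum
  rw [← Finset.sum_union]
  · congr 1
    ext i
    simp only [Finset.mem_filter, Finset.mem_univ, true_and, Finset.mem_union]
    constructor
    · rintro ⟨h1, h2⟩
      rcases le_or_gt (θ i) s with h | h
      · exact Or.inl ⟨h1, h⟩
      · exact Or.inr ⟨h, h2⟩
    · rintro (⟨h1, h2⟩ | ⟨h1, h2⟩)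
      · exact ⟨h1, h2.trans hst⟩
      · exact ⟨hrs.trans_lt h1, h2⟩
  · rw [Finset.disjoint_left]
    intro i hi hi'
    simp only [Finset.mem_filter, Finset.mem_univ, true_and] at hi hi'
    linarith [hi.2, hi'.1]

/-- Three vertices of the polygon with the given sides are positively oriented. -/
theorem planeDet_sideSum_nonneg (hρ : ∀ i, 0 ≤ ρ i)
    (hθ : ∀ i j, θ i < θ j + 2 * Real.pi) (hsum : ∑ i, polarNormal (ρ i) (θ i) = 0) {r s t : ℝ}
    (hrs : r ≤ s) (hst : s ≤ t) :
    0 ≤ planeDet (sideSum ρ θ r s) (sideSum ρ θ s t) := by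
  classical
  by_contra hneg
  push Not at hneg
  obtain ⟨R, φ, hR, hu⟩ := exists_eq_polarNormal (sideSum ρ θ r t)
  have hadd := sideSum_add (ρ := ρ) (θ := θ) hrs hst
  -- If the middle vertex is on the wrong side of the chord from `r` to `t`, then some side `a`
  -- before it and some side `b` after it have the wrong signs against the chord. The first and last
  -- sides of the arc have the right ones, which gives four alternations in less than a turn.
  have hA : planeDet (sideSum ρ θ r s) (sideSum ρ θ r t) < 0 := by
    rw [hadd, planeDet_add_right, planeDet_self]
    linarith
  have hB : 0 < planeDet (sideSum ρ θ s t) (sideSum ρ θ r t) := by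
    rw [hadd, planeDet_add_right, planeDet_self, planeDet_swap]
    linarith
  have key : ∀ i, planeDet (polarNormal (ρ i) (θ i)) (sideSum ρ θ r t) =
      ρ i * R * Real.sin (φ - θ i) := fun i => by rw [hu, planeDet_polarNormal]
  have hA' : ∃ a, (r < θ a ∧ θ a ≤ s) ∧ ρ a * R * Real.sin (φ - θ a) < 0 := by
    by_contra hc
    push Not at hc
    rw [sideSum, planeDet_sum_left] at hA
    refine absurd (Finset.sum_nonneg fun i hi => ?_) (not_le.2 hA)
    rw [key]
    exact hc i (by simpa using hi)
  have hB' : ∃ b, (s < θ b ∧ θ b ≤ t) ∧ 0 < ρ b * R * Real.sin (φ - θ b) := by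
    by_contra hc
    push Not at hc
    rw [sideSum, planeDet_sum_left] at hB
    refine absurd (Finset.sum_nonpos fun i hi => ?_) (not_le.2 hB)
    rw [key]
    exact hc i (by simpa using hi)
  obtain ⟨a, ha, hna⟩ := hA'
  obtain ⟨b, hb, hpb⟩ := hB'
  have hR0 : 0 < R := lt_of_le_of_ne hR (by rintro rfl; simp at hna)
  have ha0 : ρ a ≠ 0 := by rintro h; simp [h] at hna
  have hb0 : ρ b ≠ 0 := by rintro h; simp [h] at hpb
  have hsa : Real.sin (φ - θ a) < 0 := by
    by_contra h
    linarith [mul_nonneg (mul_nonneg (hρ a) hR) (not_lt.1 h)]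
  have hsb : 0 < Real.sin (φ - θ b) := by
    by_contra h
    linarith [mul_nonpos_of_nonneg_of_nonpos (mul_nonneg (hρ b) hR) (not_lt.1 h)]
  -- Sides of length zero carry an arbitrary angle and must not count as first or last.
  let S : Finset ι := Finset.univ.filter fun i => (r < θ i ∧ θ i ≤ t) ∧ ρ i ≠ 0
  have haS : a ∈ S := by simp [S, ha.1, ha.2.trans hst, ha0]
  have hbS : b ∈ S := by simp [S, hrs.trans_lt hb.1, hb.2, hb0]
  obtain ⟨m, hmS, hmin⟩ := S.exists_min_image θ ⟨a, haS⟩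
  obtain ⟨M, hMS, hmax⟩ := S.exists_max_image θ ⟨a, haS⟩
  have hm : (r < θ m ∧ θ m ≤ t) ∧ ρ m ≠ 0 := by simpa [S] using hmS
  have hM : (r < θ M ∧ θ M ≤ t) ∧ ρ M ≠ 0 := by simpa [S] using hMS
  have hfirst := planeDet_first_sideSum_nonneg hρ hθ hsum hm.1
    (fun i h1 h2 h3 => hmin i (by simp [S, h1, h2, h3]))
  have hlast := planeDet_last_sideSum_nonpos hρ hθ hsum hM.1
    (fun i h1 h2 h3 => hmax i (by simp [S, h1, h2, h3]))
  rw [key] at hfirst hlast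
  have hm0 : 0 < ρ m * R := mul_pos (lt_of_le_of_ne (hρ m) hm.2.symm) hR0
  have hM0 : 0 < ρ M * R := mul_pos (lt_of_le_of_ne (hρ M) hM.2.symm) hR0
  have hsm : 0 ≤ Real.sin (φ - θ m) := nonneg_of_mul_nonneg_right hfirst hm0
  have hsM : Real.sin (φ - θ M) ≤ 0 := by
    by_contra h
    linarith [mul_pos hM0 (not_le.1 h)]
  refine not_four_sign_alternations (lt_of_le_of_ne (hmin a haS) ?_)
    (ha.2.trans_lt hb.1) (lt_of_le_of_ne (hmax b hbS) ?_) (hθ M m) hsm hsa hsb hsM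
  · intro h; rw [h] at hsm; linarith
  · intro h; rw [h] at hsb; linarith

theorem sideSum_self (r : ℝ) : sideSum ρ θ r r = 0 := by
  classical
  unfold sideSum
  rw [Finset.filter_false_of_mem, Finset.sum_empty]
  rintro i - ⟨h1, h2⟩
  linarith

theorem sideSum_eq_of_no_angle {r s t : ℝ} (hrs : r ≤ s) (hst : s ≤ t)
    (h : ∀ i, s < θ i → ¬ θ i ≤ t) : sideSum ρ θ r t = sideSum ρ θ r s := by
  classical
  rw [sideSum_add hrs hst]
  have : sideSum ρ θ s t = 0 := by
    unfold sideSum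
    rw [Finset.filter_false_of_mem, Finset.sum_empty]
    rintro i - ⟨h1, h2⟩
    exact h i h1 h2
  rw [this, add_zero]

open Classical in
/-- Twice the area enclosed by the sides with normal direction at most `t`. -/
def fanArea₂ (ρ θ : ι → ℝ) (t : ℝ) : ℝ :=
  ∑ j with θ j ≤ t, ∑ i with θ i < θ j,
    planeDet (polarNormal (ρ i) (θ i)) (polarNormal (ρ j) (θ j))

/-- Induction on the number of sides used. All sides with the largest angle `θ M` are removed at
once; putting them back adds one vertex, and the area grows by the fan triangle spanned by the
origin, the previous vertex and the new one. -/
theorem volume_convexHull_sideSum (hρ : ∀ i, 0 ≤ ρ i)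
    (hθ : ∀ i j, θ i < θ j + 2 * Real.pi) (hsum : ∑ i, polarNormal (ρ i) (θ i) = 0)
    {r : ℝ} (hr : ∀ i, r < θ i) (t : ℝ) (hrt : r ≤ t) :
    0 ≤ fanArea₂ ρ θ t ∧ volume (convexHull ℝ (sideSum ρ θ r '' Set.Icc r t)) =
      ENNReal.ofReal (fanArea₂ ρ θ t / 2) := by
  classical
  induction hn : (Finset.univ.filter fun i => θ i ≤ t).card using Nat.strong_induction_on
    generalizing t with
  | _ n ih =>
    by_cases hne : (Finset.univ.filter fun i => θ i ≤ t).Nonempty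
    · obtain ⟨M, hM, hmax⟩ := Finset.exists_max_image _ θ hne
      simp only [Finset.mem_filter, Finset.mem_univ, true_and] at hM hmax
      -- a threshold just below `θ M`
      obtain ⟨t', hrt', ht'M, hgap⟩ : ∃ t', r ≤ t' ∧ t' < θ M ∧ ∀ i, θ i < θ M → θ i ≤ t' := by
        by_cases hne' : (Finset.univ.filter fun i => θ i < θ M).Nonempty
        · obtain ⟨k, hk, hkmax⟩ := Finset.exists_max_image _ θ hne'
          simp only [Finset.mem_filter, Finset.mem_univ, true_and] at hk hkmax
          exact ⟨θ k, (hr k).le, hk, hkmax⟩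
        · refine ⟨r, le_rfl, hr M, fun i hi => (hne' ⟨i, by simpa using hi⟩).elim⟩
      have hcard : (Finset.univ.filter fun i => θ i ≤ t').card < n := by
        rw [← hn]
        apply Finset.card_lt_card
        rw [Finset.ssubset_iff_of_subset]
        · exact ⟨M, by simpa using hM, by simpa using ht'M⟩
        · intro i hi
          simp only [Finset.mem_filter, Finset.mem_univ, true_and] at hi ⊢
          linarith
      obtain ⟨hpos, hvol⟩ := ih _ hcard t' hrt' rfl
      have hMt : sideSum ρ θ r t = sideSum ρ θ r (θ M) :=
        sideSum_eq_of_no_angle (hr M).le hM fun i h1 h2 => not_lt.2 (hmax i h2) h1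
      have himage : sideSum ρ θ r '' Set.Icc r t =
          insert (sideSum ρ θ r (θ M)) (sideSum ρ θ r '' Set.Icc r t') := by
        ext p
        constructor
        · rintro ⟨x, ⟨hx1, hx2⟩, rfl⟩
          rcases le_or_gt (θ M) x with h | h
          · left
            exact sideSum_eq_of_no_angle (hr M).le h fun i h1 h2 =>
              not_lt.2 (hmax i (h2.trans hx2)) h1
          · right
            rcases le_or_gt x t' with h' | h'
            · exact ⟨x, ⟨hx1, h'⟩, rfl⟩
            · refine ⟨t', ⟨hrt', le_rfl⟩, ?_⟩
              refine (sideSum_eq_of_no_angle hrt' h'.le fun i h1 h2 => ?_).symm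
              linarith [hgap i (by linarith)]
        · rintro (rfl | ⟨x, ⟨hx1, hx2⟩, rfl⟩)
          · exact ⟨θ M, ⟨(hr M).le, hM⟩, rfl⟩
          · exact ⟨x, ⟨hx1, by linarith⟩, rfl⟩
      have hsub : ∀ {x y : ℝ}, r ≤ x → x ≤ y →
          sideSum ρ θ r y - sideSum ρ θ r x = sideSum ρ θ x y := fun h1 h2 => by
        rw [sideSum_add h1 h2]; simp
      have horient := @planeDet_sideSum_nonneg ι _ ρ θ hρ hθ hsum
      have hdet : ∀ {x y : ℝ}, r ≤ x → x ≤ y →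
          0 ≤ planeDet (sideSum ρ θ r x) (sideSum ρ θ r y) := fun h1 h2 => by
        rw [sideSum_add h1 h2, planeDet_add_right, planeDet_self, zero_add]
        exact horient h1 h2
      have hstep := volume_convexHull_insert (X := sideSum ρ θ r '' Set.Icc r t')
        (q := sideSum ρ θ r t') (r := sideSum ρ θ r (θ M))
        ⟨r, ⟨le_rfl, hrt'⟩, sideSum_self r⟩ ⟨t', ⟨hrt', le_rfl⟩, rfl⟩
        (by
          rintro _ ⟨x, ⟨hx1, hx2⟩, rfl⟩
          exact hdet hx1 (by linarith))
        (by
          rintro _ ⟨x, ⟨hx1, hx2⟩, rfl⟩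
          rw [hsub hx1 hx2, hsub hrt' ht'M.le]
          exact horient hx2 ht'M.le)
        (by
          rintro _ ⟨x, ⟨hx1, hx2⟩, rfl⟩
          exact hdet hx1 hx2)
      have harea : fanArea₂ ρ θ t = fanArea₂ ρ θ t' +
          planeDet (sideSum ρ θ r t') (sideSum ρ θ r (θ M)) := by
        have h1 : (Finset.univ.filter fun i => θ i ≤ t) =
            (Finset.univ.filter fun i => θ i ≤ t') ∪
              (Finset.univ.filter fun i => t' < θ i ∧ θ i ≤ θ M) := by
          ext i
          simp only [Finset.mem_filter, Finset.mem_univ, true_and, Finset.mem_union]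
          constructor
          · intro h
            rcases le_or_gt (θ i) t' with h' | h'
            · exact Or.inl h'
            · exact Or.inr ⟨h', hmax i h⟩
          · rintro (h | h) <;> linarith
        unfold fanArea₂
        rw [h1, Finset.sum_union]
        · congr 1
          have h2 : planeDet (sideSum ρ θ r t') (sideSum ρ θ r (θ M)) =
              planeDet (sideSum ρ θ r t') (sideSum ρ θ t' (θ M)) := by
            rw [sideSum_add hrt' ht'M.le, planeDet_add_right, planeDet_self, zero_add]
          rw [h2]
          conv_rhs => rw [sideSum, sideSum, planeDet_sum_right]
          refine Finset.sum_congr rfl fun j hj => ?_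
          rw [planeDet_sum_left]
          refine Finset.sum_congr ?_ fun _ _ => rfl
          ext i
          simp only [Finset.mem_filter, Finset.mem_univ, true_and] at hj ⊢
          constructor
          · exact fun h => ⟨hr i, hgap i (by linarith)⟩
          · exact fun h => by linarith
        · rw [Finset.disjoint_left]
          intro i hi hi'
          simp only [Finset.mem_filter, Finset.mem_univ, true_and] at hi hi'
          linarith [hi'.1]
      have hd := hdet hrt' ht'M.le
      refine ⟨by linarith, ?_⟩
      rw [himage, hstep, hvol, harea, add_div, ENNReal.ofReal_add (by linarith) (by linarith)]
    · rw [Finset.not_nonempty_iff_eq_empty] at hne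
      have himage : sideSum ρ θ r '' Set.Icc r t = {0} := by
        ext p
        have : ∀ x ∈ Set.Icc r t, sideSum ρ θ r x = 0 := fun x hx => by
          rw [sideSum_eq_of_no_angle le_rfl hx.1, sideSum_self]
          intro i _ h2
          have : i ∈ Finset.univ.filter fun i => θ i ≤ t := by simpa using h2.trans hx.2
          simp [hne] at this
        constructor
        · rintro ⟨x, hx, rfl⟩
          exact this x hx
        · rintro rfl
          exact ⟨r, ⟨le_rfl, hrt⟩, sideSum_self r⟩
      rw [himage, fanArea₂, hne]
      simp

end Fan

theorem vecArg_mem_Ioc (w : ℤ × ℤ) : vecArg w ∈ Set.Ioc (-Real.pi) Real.pi :=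
  Complex.arg_mem_Ioc _

open Classical in
-- The fan formula for all sides. Turning by 90 degrees preserves determinants, so the sides may be
-- replaced by the legs themselves.
theorem volume_legPolygon {ι : Type*} [Fintype ι] (w : ι → ℤ × ℤ) (hw : ∑ i, w i = 0) :
    2 * (volume (legPolygon w)).toReal =
      ((∑ j, ∑ i with vecArg (w i) < vecArg (w j), BipartiteMap.wedge (w i) (w j) : ℤ) : ℝ) := by
  have hpi := Real.pi_pos
  let ρ : ι → ℝ := fun i => ‖(⟨((w i).1 : ℝ), ((w i).2 : ℝ)⟩ : ℂ)‖
  let θ : ι → ℝ := fun i => vecArg (w i)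
  have hv : ∀ i, polarNormal (ρ i) (θ i) = (-((w i).2 : ℝ), ((w i).1 : ℝ)) := fun i => by
    have h1 := Complex.norm_mul_cos_arg ⟨((w i).1 : ℝ), ((w i).2 : ℝ)⟩
    have h2 := Complex.norm_mul_sin_arg ⟨((w i).1 : ℝ), ((w i).2 : ℝ)⟩
    simp only at h1 h2
    simp only [polarNormal, ρ, θ, vecArg, h1, h2]
  have hsum : ∑ i, polarNormal (ρ i) (θ i) = 0 := by
    have h1 := congrArg Prod.fst hw
    have h2 := congrArg Prod.snd hw
    simp only [Prod.fst_sum, Prod.snd_sum, Prod.fst_zero, Prod.snd_zero] at h1 h2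
    simp only [hv]
    ext
    · rw [Prod.fst_sum, Finset.sum_neg_distrib, Prod.fst_zero]
      exact_mod_cast neg_eq_zero.2 h2
    · rw [Prod.snd_sum, Prod.snd_zero]
      exact_mod_cast h1
  have hlt : ∀ i, -Real.pi < θ i := fun i => (vecArg_mem_Ioc (w i)).1
  have hle : ∀ i, θ i ≤ Real.pi := fun i => (vecArg_mem_Ioc (w i)).2
  obtain ⟨hpos, hvol⟩ := volume_convexHull_sideSum (ρ := ρ) (θ := θ) (fun i => norm_nonneg _)
    (fun i j => by linarith [hlt j, hle i]) hsum hlt Real.pi (by linarith)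
  have hset : {p | ∃ t : ℝ, p = ∑ i with vecArg (w i) ≤ t, (-((w i).2 : ℝ), ((w i).1 : ℝ))} =
      sideSum ρ θ (-Real.pi) '' Set.Icc (-Real.pi) Real.pi := by
    have hq : ∀ t, sideSum ρ θ (-Real.pi) t =
        ∑ i with vecArg (w i) ≤ t, (-((w i).2 : ℝ), ((w i).1 : ℝ)) := fun t => by
      unfold sideSum
      refine Finset.sum_congr ?_ fun i _ => hv i
      ext i
      simp only [Finset.mem_filter, Finset.mem_univ, true_and]
      exact ⟨fun h => h.2, fun h => ⟨hlt i, h⟩⟩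
    ext p
    constructor
    · rintro ⟨t, rfl⟩
      -- Arguments lie in (-π, π], so thresholds outside [-π, π] give no new vertices.
      rcases lt_or_ge t (-Real.pi) with h | h
      · refine ⟨-Real.pi, ⟨le_rfl, by linarith⟩, ?_⟩
        rw [hq]
        refine Finset.sum_congr (Finset.filter_congr fun i _ => ?_) fun _ _ => rfl
        have := hlt i
        simp only [θ] at this
        constructor <;> intro <;> linarith
      rcases le_or_gt t Real.pi with h' | h'
      · exact ⟨t, ⟨h, h'⟩, hq t⟩
      · refine ⟨Real.pi, ⟨by linarith, le_rfl⟩, ?_⟩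
        rw [hq]
        refine Finset.sum_congr (Finset.filter_congr fun i _ => ?_) fun _ _ => rfl
        have := hle i
        simp only [θ] at this
        constructor <;> intro <;> linarith
    · rintro ⟨t, -, rfl⟩
      exact ⟨t, hq t⟩
  unfold legPolygon
  rw [hset, hvol, ENNReal.toReal_ofReal (by linarith), mul_div_cancel₀ _ (two_ne_zero)]
  unfold fanArea₂
  rw [Finset.filter_true_of_mem (fun i _ => hle i)]
  push_cast
  refine Finset.sum_congr rfl fun j _ => Finset.sum_congr rfl fun i _ => ?_
  rw [hv, hv]
  simp only [planeDet, BipartiteMap.wedge]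
  push_cast
  ring

/-! ### Ascents and descents around a cycle of a permutation. -/

section Cycles

variable {E : Type*}

theorem pow_minimalPeriod_apply (f : Equiv.Perm E) (e : E) :
    (f ^ Function.minimalPeriod f e) e = e := by
  rw [Equiv.Perm.coe_pow]
  exact Function.iterate_minimalPeriod

/-- `+1`, `-1` or `0` according to whether `θ` increases, decreases or stays constant from `e` to
`f e`. -/
def stepSign (f : Equiv.Perm E) (θ : E → ℝ) (e : E) : ℤ := SignType.sign (θ (f e) - θ e)

theorem stepSign_of_lt {f : Equiv.Perm E} {θ : E → ℝ} {e : E} (h : θ e < θ (f e)) :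
    stepSign f θ e = 1 := by
  simp [stepSign, sign_pos (sub_pos.2 h)]

theorem stepSign_of_gt {f : Equiv.Perm E} {θ : E → ℝ} {e : E} (h : θ (f e) < θ e) :
    stepSign f θ e = -1 := by
  simp [stepSign, sign_neg (sub_neg.2 h)]

theorem stepSign_eq_zero {f : Equiv.Perm E} {θ : E → ℝ} {e : E} :
    stepSign f θ e = 0 ↔ θ (f e) = θ e := by
  rcases lt_trichotomy (θ e) (θ (f e)) with h | h | h
  · simp [stepSign_of_lt h, h.ne']
  · simp [stepSign, h]
  · simp [stepSign_of_gt h, h.ne]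

theorem stepSign_le_one (f : Equiv.Perm E) (θ : E → ℝ) (e : E) : stepSign f θ e ≤ 1 := by
  rcases lt_trichotomy (θ e) (θ (f e)) with h | h | h
  · rw [stepSign_of_lt h]
  · rw [stepSign_eq_zero.2 h.symm]; norm_num
  · rw [stepSign_of_gt h]; norm_num

/-- `θ` increases strictly once around the cycle that starts at `m`. -/
def IncreasesFrom (f : Equiv.Perm E) (θ : E → ℝ) (m : E) : Prop :=
  ∀ i j : ℕ, i < j → j < Function.minimalPeriod f m → θ ((f ^ i) m) < θ ((f ^ j) m)

variable [Fintype E]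

open Classical in
/-- The cycle of a permutation through a point. -/
def cycleFinset (f : Equiv.Perm E) (e : E) : Finset E := {e' | f.SameCycle e e'}

theorem mem_cycleFinset {f : Equiv.Perm E} {e e' : E} :
    e' ∈ cycleFinset f e ↔ f.SameCycle e e' := by
  simp [cycleFinset]

theorem apply_mem_cycleFinset {f : Equiv.Perm E} {e e' : E} :
    f e' ∈ cycleFinset f e ↔ e' ∈ cycleFinset f e := by
  simp [mem_cycleFinset, Equiv.Perm.sameCycle_apply_right]

theorem cycleFinset_eq {f : Equiv.Perm E} {e e' : E} (h : f.SameCycle e e') :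
    cycleFinset f e = cycleFinset f e' := by
  ext x
  rw [mem_cycleFinset, mem_cycleFinset]
  exact ⟨fun hx => h.symm.trans hx, fun hx => h.trans hx⟩

theorem minimalPeriod_perm_pos (f : Equiv.Perm E) (e : E) : 0 < Function.minimalPeriod f e :=
  Function.minimalPeriod_pos_of_mem_periodicPts (f.injective.mem_periodicPts e)

theorem SameCycle.exists_pow_lt {f : Equiv.Perm E} {e e' : E} (h : f.SameCycle e e') :
    ∃ k < Function.minimalPeriod f e, (f ^ k) e = e' := by
  obtain ⟨k, hk⟩ := h.exists_nat_pow_eq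
  refine ⟨k % Function.minimalPeriod f e, Nat.mod_lt _ (minimalPeriod_perm_pos f e), ?_⟩
  rw [← hk, Equiv.Perm.coe_pow, Equiv.Perm.coe_pow, Function.iterate_mod_minimalPeriod_eq]

theorem minimalPeriod_eq_of_sameCycle {f : Equiv.Perm E} {e e' : E} (h : f.SameCycle e e') :
    Function.minimalPeriod f e' = Function.minimalPeriod f e := by
  obtain ⟨k, -, rfl⟩ := SameCycle.exists_pow_lt h
  rw [Equiv.Perm.coe_pow]
  exact Function.minimalPeriod_apply_iterate (f.injective.mem_periodicPts e) k

theorem sum_range_minimalPeriod {M : Type*} [AddCommMonoid M] (f : Equiv.Perm E) (e : E)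
    (F : E → M) :
    ∑ k ∈ Finset.range (Function.minimalPeriod f e), F ((f ^ k) e) =
      ∑ e' ∈ cycleFinset f e, F e' := by
  refine Finset.sum_bij (fun k _ => (f ^ k) e) ?_ ?_ ?_ fun _ _ => rfl
  · intro k _
    rw [mem_cycleFinset]
    exact ⟨k, by simp⟩
  · intro i hi j hj hij
    rw [Finset.mem_range] at hi hj
    simp only [Equiv.Perm.coe_pow] at hij
    exact (Function.iterate_eq_iterate_iff_of_lt_minimalPeriod hi hj).1 hij
  · intro e' he'
    obtain ⟨k, hk, rfl⟩ := SameCycle.exists_pow_lt (mem_cycleFinset.1 he')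
    exact ⟨k, Finset.mem_range.2 hk, rfl⟩

theorem card_cycleFinset (f : Equiv.Perm E) (e : E) :
    (cycleFinset f e).card = Function.minimalPeriod f e := by
  have := sum_range_minimalPeriod f e (fun _ => (1 : ℕ))
  simpa using this.symm

theorem two_le_minimalPeriod {f : Equiv.Perm E} {e : E} (h : f e ≠ e) :
    2 ≤ Function.minimalPeriod f e := by
  have h0 := minimalPeriod_perm_pos f e
  have h1 : Function.minimalPeriod f e ≠ 1 := fun h1 =>
    h (Function.minimalPeriod_eq_one_iff_isFixedPt.1 h1)
  omega

/-- The increments around the cycle add up to zero, so if none is negative, all vanish. -/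
theorem eq_of_no_descent {f : Equiv.Perm E} {θ : E → ℝ} {e : E}
    (h : ∀ e' ∈ cycleFinset f e, θ e' ≤ θ (f e')) : ∀ e' ∈ cycleFinset f e, θ (f e') = θ e' := by
  have hsum : ∑ e' ∈ cycleFinset f e, (θ (f e') - θ e') = 0 := by
    rw [Finset.sum_sub_distrib, sub_eq_zero]
    refine Finset.sum_bij (fun x _ => f x) (fun x hx => apply_mem_cycleFinset.2 hx)
      (fun x _ y _ h => f.injective h) (fun y hy => ?_) fun _ _ => rfl
    exact ⟨f.symm y, apply_mem_cycleFinset.1 (by simpa using hy), by simp⟩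
  intro e' he'
  rw [Finset.sum_eq_zero_iff_of_nonneg fun x hx => sub_nonneg.2 (h x hx)] at hsum
  exact sub_eq_zero.1 (hsum e' he')

theorem pow_pred_minimalPeriod {f : Equiv.Perm E} {d : E} :
    (f ^ (Function.minimalPeriod f d - 1)) (f d) = d := by
  rw [← Equiv.Perm.mul_apply, ← pow_succ, Nat.sub_add_cancel (minimalPeriod_perm_pos f d),
    pow_minimalPeriod_apply]

/-- Reading of the cycle starts just after its only possible descent `d`. -/
theorem increasesFrom_of_single_descent {f : Equiv.Perm E} {θ : E → ℝ} {d : E}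
    (h : ∀ e' ∈ cycleFinset f d, e' ≠ d → θ e' < θ (f e')) : IncreasesFrom f θ (f d) := by
  have hper : Function.minimalPeriod f (f d) = Function.minimalPeriod f d :=
    minimalPeriod_eq_of_sameCycle
      (Equiv.Perm.sameCycle_apply_right.2 (Equiv.Perm.SameCycle.refl f d))
  have hstep : ∀ i, i + 1 < Function.minimalPeriod f (f d) →
      θ ((f ^ i) (f d)) < θ ((f ^ (i + 1)) (f d)) := fun i hi => by
    have heq : (f ^ (i + 1)) (f d) = f ((f ^ i) (f d)) := by
      rw [pow_succ', Equiv.Perm.mul_apply]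
    rw [heq]
    refine h _ ?_ ?_
    · rw [mem_cycleFinset]
      exact ⟨i + 1, by
        rw [← Nat.cast_succ, zpow_natCast, Nat.succ_eq_add_one, pow_succ, Equiv.Perm.mul_apply]⟩
    · intro hd
      -- Starting from `f d`, the point `d` is reached only at the last index, from which no step
      -- remains.
      have h1 : (f ^ i) (f d) = (f ^ (Function.minimalPeriod f d - 1)) (f d) := by
        rw [hd, pow_pred_minimalPeriod]
      simp only [Equiv.Perm.coe_pow] at h1
      rw [Function.iterate_eq_iterate_iff_of_lt_minimalPeriod (by omega) (by omega)] at h1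
      omega
  intro i j hij hj
  induction j, hij using Nat.le_induction with
  | base => exact hstep i hj
  | succ k hk ih => exact (ih (by omega)).trans (hstep k hj)

/-- A descent costs 2 against the trivial bound by the length of the cycle. Without a descent all
signs are 0, and the length is at least 2. -/
theorem sum_stepSign_le (f : Equiv.Perm E) (θ : E → ℝ) {e : E} (he : f e ≠ e) :
    ∑ e' ∈ cycleFinset f e, stepSign f θ e' ≤ (cycleFinset f e).card - 2 := by
  classical
  have h2 := two_le_minimalPeriod he
  rw [← card_cycleFinset] at h2
  by_cases h : ∀ e' ∈ cycleFinset f e, θ e' ≤ θ (f e')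
  · rw [Finset.sum_eq_zero fun e' he' => stepSign_eq_zero.2 (eq_of_no_descent h e' he')]
    omega
  · push Not at h
    obtain ⟨d, hd, hlt⟩ := h
    rw [← Finset.sum_erase_add _ _ hd, stepSign_of_gt hlt]
    have := Finset.sum_le_card_nsmul ((cycleFinset f e).erase d) (stepSign f θ) 1
      fun x _ => stepSign_le_one f θ x
    rw [Finset.card_erase_of_mem hd, nsmul_eq_mul, mul_one] at this
    push_cast [Nat.cast_sub (show 1 ≤ (cycleFinset f e).card by omega)] at this
    linarith

/-- Equality in `sum_stepSign_le`: beside one descent all steps must be ascents. The constant case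
survives only for length 2, where both sides are 0. -/
theorem increasesFrom_of_sum_stepSign_eq {f : Equiv.Perm E} {θ : E → ℝ} {e : E} (he : f e ≠ e)
    (hsum : ∑ e' ∈ cycleFinset f e, stepSign f θ e' = (cycleFinset f e).card - 2) :
    (∃ m, f.SameCycle e m ∧ IncreasesFrom f θ m) ∨
      ((∀ e' ∈ cycleFinset f e, stepSign f θ e' = 0) ∧ (cycleFinset f e).card = 2) := by
  classical
  have h2 := two_le_minimalPeriod he
  rw [← card_cycleFinset] at h2
  by_cases h : ∀ e' ∈ cycleFinset f e, θ e' ≤ θ (f e')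
  · right
    have h0 : ∀ e' ∈ cycleFinset f e, stepSign f θ e' = 0 := fun e' he' =>
      stepSign_eq_zero.2 (eq_of_no_descent h e' he')
    rw [Finset.sum_eq_zero h0] at hsum
    exact ⟨h0, by omega⟩
  · left
    push Not at h
    obtain ⟨d, hd, hlt⟩ := h
    have hed := mem_cycleFinset.1 hd
    refine ⟨f d, Equiv.Perm.sameCycle_apply_right.2 hed, increasesFrom_of_single_descent ?_⟩
    rw [← cycleFinset_eq hed]
    rw [← Finset.sum_erase_add _ _ hd, stepSign_of_gt hlt] at hsum
    have hsum' : ∑ x ∈ (cycleFinset f e).erase d, (1 - stepSign f θ x) = 0 := by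
      rw [Finset.sum_sub_distrib, Finset.sum_const, Finset.card_erase_of_mem hd, nsmul_eq_mul,
        mul_one]
      push_cast [Nat.cast_sub (show 1 ≤ (cycleFinset f e).card by omega)]
      linarith
    rw [Finset.sum_eq_zero_iff_of_nonneg fun x _ => sub_nonneg.2 (stepSign_le_one f θ x)] at hsum'
    intro x hx hxd
    have h1 := hsum' x (Finset.mem_erase.2 ⟨hxd, hx⟩)
    rcases lt_trichotomy (θ x) (θ (f x)) with h | h | h
    · exact h
    · rw [stepSign_eq_zero.2 h.symm] at h1; norm_num at h1
    · rw [stepSign_of_gt h] at h1; norm_num at h1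

theorem sum_stepSign_of_increasesFrom {f : Equiv.Perm E} {θ : E → ℝ} {m : E} (hm : f m ≠ m)
    (h : IncreasesFrom f θ m) :
    ∑ e' ∈ cycleFinset f m, stepSign f θ e' = (cycleFinset f m).card - 2 := by
  have h2 := two_le_minimalPeriod hm
  rw [card_cycleFinset, ← sum_range_minimalPeriod]
  obtain ⟨n, hn⟩ : ∃ n, Function.minimalPeriod f m = n + 1 :=
    ⟨_, (Nat.sub_add_cancel (by omega)).symm⟩
  have hsucc : ∀ k, f ((f ^ k) m) = (f ^ (k + 1)) m := fun k => by
    rw [pow_succ', Equiv.Perm.mul_apply]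
  rw [hn, Finset.sum_range_succ, Finset.sum_congr rfl (g := fun _ => 1), stepSign_of_gt]
  · simp
    ring
  · rw [hsucc, ← hn, pow_minimalPeriod_apply]
    simpa using h 0 n (by omega) (by omega)
  · intro k hk
    rw [Finset.mem_range] at hk
    apply stepSign_of_lt
    rw [hsucc]
    exact h k (k + 1) (by omega) (by omega)

open Classical in
theorem sum_sum_cycleFinset {M : Type*} [AddCommMonoid M] (f : Equiv.Perm E) (F : E → M) :
    ∑ c : Quotient (Equiv.Perm.SameCycle.setoid f), ∑ e ∈ cycleFinset f c.out, F e = ∑ e, F e := by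
  rw [← Finset.sum_fiberwise (s := Finset.univ)
    (g := fun e => (Quotient.mk (Equiv.Perm.SameCycle.setoid f) e)) (f := F)]
  refine Finset.sum_congr rfl fun c _ => Finset.sum_congr ?_ fun _ _ => rfl
  ext e
  simp only [mem_cycleFinset, Finset.mem_filter, Finset.mem_univ, true_and]
  rw [eq_comm]
  conv_rhs => rw [← Quotient.out_eq c]
  exact ⟨fun h => Quotient.sound (s := Equiv.Perm.SameCycle.setoid f) h,
    fun h => Quotient.exact (s := Equiv.Perm.SameCycle.setoid f) h⟩

/-- The bounds n - 2 of the single cycles add up, the lengths n having the sum `Fintype.card E`. -/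
theorem sum_stepSign_univ_le {f : Equiv.Perm E} (θ : E → ℝ) (hf : ∀ e, f e ≠ e) :
    ∑ e, stepSign f θ e ≤
      Fintype.card E - 2 * Nat.card (Quotient (Equiv.Perm.SameCycle.setoid f)) := by
  classical
  have h1 := sum_sum_cycleFinset f (fun _ => (1 : ℤ))
  rw [← sum_sum_cycleFinset f]
  refine (Finset.sum_le_sum fun c _ => sum_stepSign_le f θ (hf c.out)).trans ?_
  simp only [Finset.sum_const, nsmul_eq_mul, mul_one, Finset.card_univ] at h1
  rw [Finset.sum_sub_distrib, h1]
  simp [Nat.card_eq_fintype_card, mul_comm]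

theorem sum_stepSign_univ_eq_iff {f : Equiv.Perm E} (θ : E → ℝ) (hf : ∀ e, f e ≠ e) :
    ∑ e, stepSign f θ e =
        Fintype.card E - 2 * Nat.card (Quotient (Equiv.Perm.SameCycle.setoid f)) ↔
      ∀ e, ∑ e' ∈ cycleFinset f e, stepSign f θ e' = (cycleFinset f e).card - 2 := by
  classical
  have h1 := sum_sum_cycleFinset f (fun _ => (1 : ℤ))
  simp only [Finset.sum_const, nsmul_eq_mul, mul_one, Finset.card_univ] at h1
  have h2 : (Fintype.card E - 2 * Nat.card (Quotient (Equiv.Perm.SameCycle.setoid f)) : ℤ) =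
      ∑ c : Quotient (Equiv.Perm.SameCycle.setoid f), ((cycleFinset f c.out).card - 2 : ℤ) := by
    rw [Finset.sum_sub_distrib, h1]
    simp [Nat.card_eq_fintype_card, mul_comm]
  rw [h2, ← sum_sum_cycleFinset f,
    Finset.sum_eq_sum_iff_of_le fun c _ => sum_stepSign_le f θ (hf c.out)]
  constructor
  · intro h e
    have hc := h (Quotient.mk _ e) (Finset.mem_univ _)
    have : f.SameCycle (Quotient.mk (Equiv.Perm.SameCycle.setoid f) e).out e :=
      Quotient.mk_out (s := Equiv.Perm.SameCycle.setoid f) e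
    rwa [cycleFinset_eq this] at hc
  · exact fun h c _ => h c.out

end Cycles

/-! ### Circular order of directions versus linear order of arguments. -/

section CircularOrder

theorem sbtw_coe_angle_iff {x y z : ℝ} (hx : x ∈ Set.Ioc (-Real.pi) Real.pi)
    (hy : y ∈ Set.Ioc (-Real.pi) Real.pi) (hz : z ∈ Set.Ioc (-Real.pi) Real.pi) :
    sbtw (x : Real.Angle) (y : Real.Angle) (z : Real.Angle) ↔
      (x < y ∧ y < z) ∨ (y < z ∧ z < x) ∨ (z < x ∧ x < y) := by
  obtain ⟨hx1, hx2⟩ := hx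
  obtain ⟨hy1, hy2⟩ := hy
  obtain ⟨hz1, hz2⟩ := hz
  have hp : 0 < 2 * Real.pi := by positivity
  have : Fact (0 < 2 * Real.pi) := ⟨hp⟩
  have hbtw : btw (z : Real.Angle) (y : Real.Angle) (x : Real.Angle) ↔
      toIcoMod hp z y ≤ toIocMod hp z x := QuotientAddGroup.btw_coe_iff
  rw [sbtw_iff_not_btw, hbtw, not_le]
  -- Measured from `z`, the representatives of `y` and `x` move up by 2π exactly when they lie below
  -- `z`; for `x`, also when it equals `z`.
  have hico1 : z ≤ y → toIcoMod hp z y = y := fun h =>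
    (toIcoMod_eq_self hp).2 ⟨h, by linarith⟩
  have hico2 : y < z → toIcoMod hp z y = y + 2 * Real.pi := fun h => by
    rw [← toIcoMod_add_right hp, toIcoMod_eq_self hp]
    exact ⟨by linarith, by linarith⟩
  have hioc1 : z < x → toIocMod hp z x = x := fun h =>
    (toIocMod_eq_self hp).2 ⟨h, by linarith⟩
  have hioc2 : x ≤ z → toIocMod hp z x = x + 2 * Real.pi := fun h => by
    rw [← toIocMod_add_right hp, toIocMod_eq_self hp]
    exact ⟨by linarith, by linarith⟩
  rcases le_or_gt z y with h | h <;> rcases lt_or_ge z x with h' | h'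
  · rw [hico1 h, hioc1 h']
    constructor
    · exact fun h'' => Or.inr (Or.inr ⟨h', h''⟩)
    · rintro (h'' | h'' | h'') <;> linarith
  · rw [hico1 h, hioc2 h']
    constructor
    · intro h''; linarith
    · rintro (h'' | h'' | h'') <;> linarith
  · rw [hico2 h, hioc1 h']
    constructor
    · exact fun _ => Or.inr (Or.inl ⟨h, h'⟩)
    · intro _; linarith
  · rw [hico2 h, hioc2 h']
    constructor
    · exact fun h'' => Or.inl ⟨by linarith, h⟩
    · rintro (h'' | h'' | h'') <;> linarith

theorem vecDir_eq_iff (u v : ℤ × ℤ) : vecDir u = vecDir v ↔ vecArg u = vecArg v := by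
  refine ⟨fun h => ?_, fun h => by rw [vecDir, vecDir, h]⟩
  have := congrArg Real.Angle.toReal h
  rwa [vecDir, vecDir, Real.Angle.toReal_coe_eq_self_iff_mem_Ioc.2 (vecArg_mem_Ioc u),
    Real.Angle.toReal_coe_eq_self_iff_mem_Ioc.2 (vecArg_mem_Ioc v)] at this

theorem sbtw_vecDir_iff (u v w : ℤ × ℤ) : sbtw (vecDir u) (vecDir v) (vecDir w) ↔
    (vecArg u < vecArg v ∧ vecArg v < vecArg w) ∨ (vecArg v < vecArg w ∧ vecArg w < vecArg u) ∨
      (vecArg w < vecArg u ∧ vecArg u < vecArg v) :=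
  sbtw_coe_angle_iff (vecArg_mem_Ioc u) (vecArg_mem_Ioc v) (vecArg_mem_Ioc w)

variable {E : Type*} [Fintype E]

theorem IncreasesFrom.circular {f : Equiv.Perm E} {W : E → ℤ × ℤ} {m : E}
    (h : IncreasesFrom f (fun e => vecArg (W e)) m) {e : E} (he : f.SameCycle m e) {i j : ℕ}
    (hi : 0 < i) (hij : i < j) (hj : j < Function.minimalPeriod f e) :
    sbtw (vecDir (W e)) (vecDir (W ((f ^ i) e))) (vecDir (W ((f ^ j) e))) := by
  rw [minimalPeriod_eq_of_sameCycle he] at hj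
  obtain ⟨t, ht, rfl⟩ := SameCycle.exists_pow_lt he
  have hadd : ∀ k, (f ^ k) ((f ^ t) m) = (f ^ (t + k)) m := fun k => by
    rw [← Equiv.Perm.mul_apply, ← pow_add, add_comm]
  have hwrap : ∀ k, Function.minimalPeriod f m ≤ k →
      (f ^ k) m = (f ^ (k - Function.minimalPeriod f m)) m := fun k hk => by
    conv_lhs => rw [← Nat.sub_add_cancel hk, pow_add, Equiv.Perm.mul_apply, pow_minimalPeriod_apply]
  rw [sbtw_vecDir_iff, hadd, hadd]
  -- The three cyclic forms of betweenness correspond to neither, only the later, or both of the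
  -- positions `t + i`, `t + j` having passed the end of the cycle.
  rcases lt_or_ge (t + j) (Function.minimalPeriod f m) with h1 | h1
  · exact Or.inl ⟨h _ _ (by omega) (by omega), h _ _ (by omega) (by omega)⟩
  · rw [hwrap _ h1]
    rcases lt_or_ge (t + i) (Function.minimalPeriod f m) with h2 | h2
    · exact Or.inr (Or.inr ⟨h _ _ (by omega) (by omega), h _ _ (by omega) (by omega)⟩)
    · rw [hwrap _ h2]
      exact Or.inr (Or.inl ⟨h _ _ (by omega) (by omega), h _ _ (by omega) (by omega)⟩)

theorem IncreasesFrom.apply_ne {f : Equiv.Perm E} {θ : E → ℝ} {m : E}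
    (h : IncreasesFrom f θ m) {e : E} (he : f.SameCycle m e) (hf : f e ≠ e) : θ e ≠ θ (f e) := by
  have h2 := two_le_minimalPeriod hf
  rw [minimalPeriod_eq_of_sameCycle he] at h2
  obtain ⟨t, ht, rfl⟩ := SameCycle.exists_pow_lt he
  have hsucc : f ((f ^ t) m) = (f ^ (t + 1)) m := by rw [pow_succ', Equiv.Perm.mul_apply]
  rw [hsucc]
  rcases lt_or_ge (t + 1) (Function.minimalPeriod f m) with h1 | h1
  · exact (h _ _ (by omega) h1).ne
  · have : t + 1 = Function.minimalPeriod f m := by omega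
    rw [this, pow_minimalPeriod_apply]
    exact (by simpa using h 0 t (by omega) ht : θ m < θ ((f ^ t) m)).ne'

/-- Start where the argument is minimal: only one of the three cyclic forms of betweenness is then
possible. -/
theorem exists_increasesFrom_of_circular {f : Equiv.Perm E} {W : E → ℤ × ℤ} {e : E}
    (h1 : ∀ e', f.SameCycle e e' → vecDir (W e') ≠ vecDir (W (f e')))
    (h2 : ∀ e', f.SameCycle e e' → ∀ i j : ℕ, 0 < i → i < j → j < Function.minimalPeriod f e' →
      sbtw (vecDir (W e')) (vecDir (W ((f ^ i) e'))) (vecDir (W ((f ^ j) e')))) :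
    ∃ m, f.SameCycle e m ∧ IncreasesFrom f (fun e => vecArg (W e)) m := by
  obtain ⟨m, hm, hmin⟩ := (cycleFinset f e).exists_min_image (fun e => vecArg (W e))
    ⟨e, mem_cycleFinset.2 (Equiv.Perm.SameCycle.refl f e)⟩
  have hem := mem_cycleFinset.1 hm
  have hmin' : ∀ k : ℕ, vecArg (W m) ≤ vecArg (W ((f ^ k) m)) := fun k =>
    hmin _ (mem_cycleFinset.2 (hem.trans ⟨k, by simp⟩))
  have hpos : ∀ i j : ℕ, 0 < i → i < j → j < Function.minimalPeriod f m →
      vecArg (W m) < vecArg (W ((f ^ i) m)) ∧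
        vecArg (W ((f ^ i) m)) < vecArg (W ((f ^ j) m)) := fun i j hi hij hj => by
    rcases (sbtw_vecDir_iff _ _ _).1 (h2 m hem i j hi hij hj) with h | h | h
    · exact h
    · linarith [hmin' j, h.2]
    · linarith [hmin' j, h.1]
  refine ⟨m, hem, fun i j hij hj => ?_⟩
  rcases Nat.eq_zero_or_pos i with rfl | hi
  · simp only [pow_zero, Equiv.Perm.one_apply]
    rcases Nat.lt_or_ge 1 j with h | h
    · exact (hpos 1 j one_pos h hj).1.trans (hpos 1 j one_pos h hj).2
    · obtain rfl : j = 1 := by omega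
      refine lt_of_le_of_ne (hmin' 1) fun h => h1 m hem ?_
      rw [vecDir_eq_iff]
      simpa using h
  · exact (hpos i j hi hij hj).2

end CircularOrder

theorem perm_apply_inv {E : Type*} (σ : Equiv.Perm E) (e : E) : σ (σ⁻¹ e) = e :=
  Equiv.apply_symm_apply σ e

theorem perm_inv_apply {E : Type*} (σ : Equiv.Perm E) (e : E) : σ⁻¹ (σ e) = e :=
  Equiv.symm_apply_apply σ e

/-! ### Incidences of edges, nodes, faces and zigzag paths; connectedness. -/

namespace BipartiteMap

variable {E : Type*} {D : BipartiteMap E}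

theorem whiteEnd_white (e : E) : D.whiteEnd (D.white e) = D.whiteEnd e :=
  Quotient.sound (s := Equiv.Perm.SameCycle.setoid D.white)
    (Equiv.Perm.sameCycle_apply_left.2 (Equiv.Perm.SameCycle.refl _ _))

theorem blackEnd_black (e : E) : D.blackEnd (D.black e) = D.blackEnd e :=
  Quotient.sound (s := Equiv.Perm.SameCycle.setoid D.black)
    (Equiv.Perm.sameCycle_apply_left.2 (Equiv.Perm.SameCycle.refl _ _))

theorem leftFace_facePerm (e : E) : D.leftFace (D.facePerm e) = D.leftFace e :=
  Quotient.sound (s := Equiv.Perm.SameCycle.setoid D.facePerm)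
    (Equiv.Perm.sameCycle_apply_left.2 (Equiv.Perm.SameCycle.refl _ _))

theorem zigzagOf_zigzagPerm (e : E) : D.zigzagOf (D.zigzagPerm e) = D.zigzagOf e :=
  Quotient.sound (s := Equiv.Perm.SameCycle.setoid D.zigzagPerm)
    (Equiv.Perm.sameCycle_apply_left.2 (Equiv.Perm.SameCycle.refl _ _))

theorem whiteEnd_eq_iff {e e' : E} : D.whiteEnd e = D.whiteEnd e' ↔ D.white.SameCycle e e' :=
  ⟨fun h => Quotient.exact (s := Equiv.Perm.SameCycle.setoid D.white) h,
    fun h => Quotient.sound (s := Equiv.Perm.SameCycle.setoid D.white) h⟩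

theorem blackEnd_eq_iff {e e' : E} : D.blackEnd e = D.blackEnd e' ↔ D.black.SameCycle e e' :=
  ⟨fun h => Quotient.exact (s := Equiv.Perm.SameCycle.setoid D.black) h,
    fun h => Quotient.sound (s := Equiv.Perm.SameCycle.setoid D.black) h⟩

theorem leftFace_eq_iff {e e' : E} : D.leftFace e = D.leftFace e' ↔ D.facePerm.SameCycle e e' :=
  ⟨fun h => Quotient.exact (s := Equiv.Perm.SameCycle.setoid D.facePerm) h,
    fun h => Quotient.sound (s := Equiv.Perm.SameCycle.setoid D.facePerm) h⟩

theorem facePerm_apply (e : E) : D.facePerm e = D.white⁻¹ (D.black⁻¹ e) := rfl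

theorem whiteEnd_white_inv (e : E) : D.whiteEnd (D.white⁻¹ e) = D.whiteEnd e := by
  rw [← whiteEnd_white, perm_apply_inv]

theorem blackEnd_black_inv (e : E) : D.blackEnd (D.black⁻¹ e) = D.blackEnd e := by
  rw [← blackEnd_black, perm_apply_inv]

theorem leftFace_white_inv (e : E) : D.leftFace (D.white⁻¹ e) = D.rightFace e := by
  have h := leftFace_facePerm (D := D) (D.black e)
  rwa [facePerm_apply, perm_inv_apply] at h

theorem zigzagOf_white_inv (e : E) : D.zigzagOf (D.white⁻¹ e) = D.zigzagOf (D.black⁻¹ e) := by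
  rw [← zigzagOf_zigzagPerm, zigzagPerm, Equiv.Perm.mul_apply, perm_apply_inv]

theorem exists_whiteEnd_eq (w : D.WhiteNode) : ∃ e, D.whiteEnd e = w := Quotient.exists_rep w

theorem exists_blackEnd_eq (b : D.BlackNode) : ∃ e, D.blackEnd e = b := Quotient.exists_rep b

theorem exists_leftFace_eq (f : D.Face) : ∃ e, D.leftFace e = f := Quotient.exists_rep f

theorem nonempty_edge (hconn : D.graph.Connected) : Nonempty E := by
  obtain ⟨w | b⟩ := hconn.nonempty
  · exact ⟨(exists_whiteEnd_eq w).choose⟩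
  · exact ⟨(exists_blackEnd_eq b).choose⟩

variable [Fintype E]

theorem sameCycle_induction {f : Equiv.Perm E} {p : E → Prop} (hp : ∀ e, p e → p (f e)) {e e' : E}
    (h : f.SameCycle e e') (he : p e) : p e' := by
  obtain ⟨k, -, rfl⟩ := SameCycle.exists_pow_lt h
  induction k with
  | zero => simpa using he
  | succ k ih =>
    rw [pow_succ', Equiv.Perm.mul_apply]
    exact hp _ (ih ⟨k, by simp⟩)

/-- In a connected dimer, all edges can be reached by rotating around nodes. -/
theorem edge_induction (hconn : D.graph.Connected) {p : E → Prop} (hw : ∀ e, p e → p (D.white e))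
    (hb : ∀ e, p e → p (D.black e)) {e : E} (he : p e) (e' : E) : p e' := by
  let N : D.Node → Prop := fun v =>
    ∀ e, v = Sum.inl (D.whiteEnd e) ∨ v = Sum.inr (D.blackEnd e) → p e
  have hNw : ∀ e, p e → N (Sum.inl (D.whiteEnd e)) := by
    rintro e he x (h | h)
    · exact sameCycle_induction hw (whiteEnd_eq_iff.1 (Sum.inl.inj h)) he
    · cases h
  have hNb : ∀ e, p e → N (Sum.inr (D.blackEnd e)) := by
    rintro e he x (h | h)
    · cases h
    · exact sameCycle_induction hb (blackEnd_eq_iff.1 (Sum.inr.inj h)) he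
  have hwalk : ∀ u v : D.Node, D.graph.Walk u v → N u → N v := by
    intro u v W
    induction W with
    | nil => exact id
    | cons hadj _ ih =>
      intro hu
      apply ih
      obtain ⟨x, ⟨h1, h2⟩ | ⟨h1, h2⟩⟩ := hadj
      · rw [h2]
        exact hNb x (hu x (Or.inl h1))
      · rw [h1]
        exact hNw x (hu x (Or.inr h2))
  obtain ⟨W⟩ := hconn.preconnected (Sum.inl (D.whiteEnd e)) (Sum.inl (D.whiteEnd e'))
  exact hwalk _ _ W (hNw e he) e' (Or.inl rfl)

end BipartiteMap

/-! ### Rational linear algebra and telescoping sums. -/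

/-- A vector that is orthogonal to the kernel of a matrix is a combination of its rows. -/
theorem exists_vecMul_eq_of_orthogonal {m n : Type*} [Fintype m] [Fintype n] (M : Matrix m n ℚ)
    (x : n → ℚ) (h : ∀ z, M.mulVec z = 0 → z ⬝ᵥ x = 0) : ∃ g : m → ℚ, Matrix.vecMul g M = x := by
  classical
  let φ : Module.Dual ℚ (n → ℚ) := ∑ i, x i • LinearMap.proj i
  have hφ : ∀ z, φ z = z ⬝ᵥ x := fun z => by
    simp [φ, dotProduct, LinearMap.sum_apply, mul_comm]
  have hmem : φ ∈ M.mulVecLin.ker.dualAnnihilator := by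
    rw [Submodule.mem_dualAnnihilator]
    intro z hz
    rw [hφ]
    exact h z (by simpa using hz)
  rw [← LinearMap.range_dualMap_eq_dualAnnihilator_ker] at hmem
  obtain ⟨ψ, hψ⟩ := hmem
  refine ⟨fun i => ψ fun j => if i = j then 1 else 0, funext fun j => ?_⟩
  have h1 := LinearMap.congr_fun hψ (Pi.single j 1)
  rw [hφ, single_one_dotProduct, LinearMap.dualMap_apply, Matrix.mulVecLin_apply,
    Matrix.mulVec_single_one] at h1
  rw [← h1, LinearMap.pi_apply_eq_sum_univ ψ]
  simp [Matrix.vecMul, dotProduct, mul_comm]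

theorem sum_comp_sub_eq_zero {E : Type*} [Fintype E] {M : Type*} [AddCommGroup M]
    (σ : Equiv.Perm E) (u : E → M) : ∑ e, (u (σ e) - u e) = 0 := by
  rw [Finset.sum_sub_distrib, Equiv.sum_comp σ u, sub_self]

/-- A discrete Stokes theorem: identities for sums over edges are checked pointwise, up to
differences along two permutations. -/
theorem sum_eq_of_telescoping {E : Type*} [Fintype E] {F G : E → ℚ} (σ τ : Equiv.Perm E)
    (u v : E → ℚ) (h : ∀ e, F e = G e + (u (σ e) - u e) + (v (τ e) - v e)) :
    ∑ e, F e = ∑ e, G e := by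
  rw [Finset.sum_congr rfl fun e _ => h e, Finset.sum_add_distrib, Finset.sum_add_distrib,
    sum_comp_sub_eq_zero, sum_comp_sub_eq_zero, add_zero, add_zero]

/-- A function whose sum over every cycle of `f` vanishes is a difference along `f`. -/
theorem exists_potential {E : Type*} [Fintype E] (f : Equiv.Perm E) (h : E → ℚ)
    (hsum : ∀ e, ∑ e' ∈ cycleFinset f e, h e' = 0) : ∃ p : E → ℚ, ∀ e, p (f e) - p e = h e := by
  -- Partial sums from `e`. Averaging them over the whole cycle gives a potential without choosing a
  -- base point on each cycle, at the price of rational values.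
  let S : E → ℕ → ℚ := fun e k => ∑ i ∈ Finset.range k, h ((f ^ i) e)
  refine ⟨fun e => -(∑ k ∈ Finset.range (Function.minimalPeriod f e), S e k) /
    Function.minimalPeriod f e, fun e => ?_⟩
  have hper : Function.minimalPeriod f (f e) = Function.minimalPeriod f e :=
    minimalPeriod_eq_of_sameCycle
      (Equiv.Perm.sameCycle_apply_right.2 (Equiv.Perm.SameCycle.refl f e))
  have hN := minimalPeriod_perm_pos f e
  have hS : ∀ k, S (f e) k = S e (k + 1) - h e := fun k => by
    simp only [S]
    rw [Finset.sum_range_succ']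
    simp [pow_succ]
  have hSN : S e (Function.minimalPeriod f e) = 0 := by
    simp only [S]
    rw [sum_range_minimalPeriod, hsum]
  simp only [hper, hS]
  set N := Function.minimalPeriod f e
  have hshift : ∑ k ∈ Finset.range N, S e (k + 1) = ∑ k ∈ Finset.range N, S e k := by
    have h1 := Finset.sum_range_succ (S e) N
    rw [Finset.sum_range_succ', hSN] at h1
    simpa [S] using h1
  rw [Finset.sum_sub_distrib, hshift]
  simp only [Finset.sum_const, Finset.card_range, nsmul_eq_mul]
  have hN' : (N : ℚ) ≠ 0 := by exact_mod_cast hN.ne'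
  field_simp
  ring

/-! ### The cup product of cellular cochains on the faces. -/

namespace BipartiteMap

variable {E : Type*} {D : BipartiteMap E}

section CupForm

/-- `p` is the potential of the 1-cochain `x` at the white corners of the faces. -/
def IsPotential (D : BipartiteMap E) (x p : E → ℚ) : Prop :=
  ∀ e, p (D.facePerm e) - p e = x e - x (D.black⁻¹ e)

/-- The coboundary of a function on the nodes, `γ` at white and `κ` at black ones, develops to that
function itself. -/
theorem isPotential_coboundary {γ κ : E → ℚ} (hγ : ∀ e, γ (D.white⁻¹ e) = γ e)
    (hκ : ∀ e, κ (D.black⁻¹ e) = κ e) : D.IsPotential (κ - γ) γ := by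
  intro e
  rw [facePerm_apply, hγ, Pi.sub_apply, Pi.sub_apply, hκ]
  ring

theorem IsPotential.add {x p x' p' : E → ℚ} (h : D.IsPotential x p) (h' : D.IsPotential x' p') :
    D.IsPotential (x + x') (p + p') := by
  intro e
  have := h e
  have := h' e
  simp only [Pi.add_apply]
  linarith

theorem IsPotential.smul {x p : E → ℚ} (c : ℚ) (h : D.IsPotential x p) :
    D.IsPotential (c • x) (c • p) := by
  intro e
  simp only [Pi.smul_apply, smul_eq_mul, ← mul_sub, h e]

open Classical in
/-- The indicator function of the edges that a zigzag path traverses from black to white. -/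
def onZigzag (Z : D.Zigzag) (e : E) : ℤ := if D.zigzagOf e = Z then 1 else 0

theorem onZigzag_white_inv (Z : D.Zigzag) (e : E) :
    onZigzag Z (D.white⁻¹ e) = onZigzag Z (D.black⁻¹ e) := by
  rw [onZigzag, onZigzag, zigzagOf_white_inv]

/-- The 1-chain of a zigzag path. -/
def zigzagChain (Z : D.Zigzag) (e : E) : ℤ := onZigzag Z (D.white⁻¹ e) - onZigzag Z e

/-- The number of crossings of an edge with the strand of a zigzag path, which has the white nodes
on its left. -/
def zigzagCochain (Z : D.Zigzag) (e : E) : ℤ := onZigzag Z e + onZigzag Z (D.white⁻¹ e)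

theorem isPotential_zigzagCochain (Z : D.Zigzag) :
    D.IsPotential (fun e => zigzagCochain Z e) fun e => -onZigzag Z e := by
  intro e
  simp only [zigzagCochain, facePerm_apply]
  rw [onZigzag_white_inv Z e]
  push_cast
  ring

variable [Fintype E]

/-- The antisymmetrized cup product of the cellular 1-cochains `x` and `y` on the fundamental class.
The functions `p` and `q` develop `x` and `y` along the boundaries of the faces. -/
def cupForm (D : BipartiteMap E) (x p y q : E → ℚ) : ℚ :=
  ∑ e, (p e * (y e - y (D.black⁻¹ e)) - q e * (x e - x (D.black⁻¹ e)) -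
    x e * y (D.black⁻¹ e) + y e * x (D.black⁻¹ e))

theorem cupForm_swap (x p y q : E → ℚ) : D.cupForm x p y q = -D.cupForm y q x p := by
  unfold cupForm
  rw [← Finset.sum_neg_distrib]
  exact Finset.sum_congr rfl fun e _ => by ring

theorem cupForm_self (x p : E → ℚ) : D.cupForm x p x p = 0 :=
  Finset.sum_eq_zero fun e _ => by ring

theorem cupForm_add_left (x p x' p' y q : E → ℚ) :
    D.cupForm (x + x') (p + p') y q = D.cupForm x p y q + D.cupForm x' p' y q := by
  unfold cupForm
  rw [← Finset.sum_add_distrib]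
  refine Finset.sum_congr rfl fun e _ => ?_
  simp only [Pi.add_apply]
  ring

theorem cupForm_smul_left (c : ℚ) (x p y q : E → ℚ) :
    D.cupForm (c • x) (c • p) y q = c * D.cupForm x p y q := by
  unfold cupForm
  rw [Finset.mul_sum]
  refine Finset.sum_congr rfl fun e _ => ?_
  simp only [Pi.smul_apply, smul_eq_mul]
  ring

/-- Two potentials of `x` differ by a constant on every face, and the increments of `q` around a
face cancel. -/
theorem cupForm_eq_of_isPotential {x p p' y q : E → ℚ} (hp : D.IsPotential x p)
    (hp' : D.IsPotential x p') (hq : D.IsPotential y q) :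
    D.cupForm x p y q = D.cupForm x p' y q := by
  unfold cupForm
  rw [← sub_eq_zero, ← Finset.sum_sub_distrib]
  rw [← sum_comp_sub_eq_zero D.facePerm fun e => (p e - p' e) * q e]
  refine Finset.sum_congr rfl fun e _ => ?_
  have h1 : p (D.facePerm e) - p' (D.facePerm e) = p e - p' e := by linarith [hp e, hp' e]
  have h2 := hq e
  rw [h1, ← h2]
  ring

/-- The form depends only on the cohomology class: on a coboundary the summand is a difference along
faces plus one around black nodes. -/
theorem cupForm_coboundary {γ κ y q : E → ℚ} (hγ : ∀ e, γ (D.white⁻¹ e) = γ e)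
    (hκ : ∀ e, κ (D.black⁻¹ e) = κ e) (hq : D.IsPotential y q) :
    D.cupForm (κ - γ) γ y q = 0 := by
  unfold cupForm
  rw [← Finset.sum_const_zero (ι := E) (s := Finset.univ)]
  refine sum_eq_of_telescoping D.facePerm D.black⁻¹ (fun e => -(γ e * q e))
    (fun e => -((κ e + γ e) * y e)) fun e => ?_
  have h3 : γ (D.facePerm e) = γ (D.black⁻¹ e) := hγ _
  have h4 : q (D.facePerm e) = q e + (y e - y (D.black⁻¹ e)) := by linarith [hq e]
  simp only [Pi.sub_apply, hκ, h3, h4]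
  ring

/-- The local core of Poincaré duality: cupping with the crossing cochain of `Z` is integration
along `Z`. The factor 2 comes from the antisymmetrization. -/
theorem cupForm_zigzagCochain (Z : D.Zigzag) {y q : E → ℚ} (hq : D.IsPotential y q) :
    D.cupForm (fun e => zigzagCochain Z e) (fun e => -onZigzag Z e) y q =
      2 * ∑ e, (zigzagChain Z e : ℚ) * y e := by
  unfold cupForm
  rw [Finset.mul_sum]
  refine sum_eq_of_telescoping D.facePerm D.black⁻¹ (fun e => onZigzag Z e * q e)
    (fun e => (onZigzag Z (D.white⁻¹ e) - onZigzag Z e) * y e) fun e => ?_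
  have h3 := onZigzag_white_inv Z e
  have h4 : q (D.facePerm e) = q e + (y e - y (D.black⁻¹ e)) := by linarith [hq e]
  simp only [zigzagCochain, zigzagChain, h4]
  simp only [facePerm_apply, h3]
  push_cast
  ring

end CupForm

end BipartiteMap

/-! ### Homology of the marked torus and Poincaré duality. -/

namespace BipartiteMap

variable {E : Type*} {D : BipartiteMap E}

/-- The boundary map from 2-chains to 1-chains. -/
def faceBoundary (D : BipartiteMap E) : (D.Face → ℚ) →ₗ[ℚ] (E → ℚ) where
  toFun c e := c (D.leftFace e) - c (D.rightFace e)
  map_add' c c' := by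
    ext e
    simp only [Pi.add_apply]
    ring
  map_smul' a c := by
    ext e
    simp only [Pi.smul_apply, smul_eq_mul, RingHom.id_apply]
    ring

theorem faceBoundary_apply (c : D.Face → ℚ) (e : E) :
    D.faceBoundary c e = c (D.leftFace e) - c (D.rightFace e) := rfl

variable [Fintype E]

/-- The first component of the displacements. -/
def TorusMarking.dispX (T : D.TorusMarking) (e : E) : ℚ := (T.disp e).1

/-- The second component of the displacements. -/
def TorusMarking.dispY (T : D.TorusMarking) (e : E) : ℚ := (T.disp e).2

theorem sum_cycleFinset_facePerm_disp (T : D.TorusMarking) (e : E) :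
    ∑ e' ∈ cycleFinset D.facePerm e, (T.disp e' - T.disp (D.black⁻¹ e')) = 0 := by
  classical
  rw [← T.face_closed (D.leftFace e)]
  refine Finset.sum_congr ?_ fun _ _ => rfl
  ext x
  rw [mem_cycleFinset, Finset.mem_filter, eq_comm (a := D.leftFace x), leftFace_eq_iff]
  simp

theorem sum_cycleFinset_facePerm_dispX (T : D.TorusMarking) (e : E) :
    ∑ e' ∈ cycleFinset D.facePerm e, (T.dispX e' - T.dispX (D.black⁻¹ e')) = 0 := by
  have := congrArg Prod.fst (sum_cycleFinset_facePerm_disp T e)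
  rw [Prod.fst_sum] at this
  simp only [TorusMarking.dispX]
  exact_mod_cast this

theorem sum_cycleFinset_facePerm_dispY (T : D.TorusMarking) (e : E) :
    ∑ e' ∈ cycleFinset D.facePerm e, (T.dispY e' - T.dispY (D.black⁻¹ e')) = 0 := by
  have := congrArg Prod.snd (sum_cycleFinset_facePerm_disp T e)
  rw [Prod.snd_sum] at this
  simp only [TorusMarking.dispY]
  exact_mod_cast this

theorem exists_isPotential_dispX (T : D.TorusMarking) : ∃ p, D.IsPotential T.dispX p :=
  exists_potential D.facePerm (fun e => T.dispX e - T.dispX (D.black⁻¹ e))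
    (sum_cycleFinset_facePerm_dispX T)

theorem exists_isPotential_dispY (T : D.TorusMarking) : ∃ q, D.IsPotential T.dispY q :=
  exists_potential D.facePerm (fun e => T.dispY e - T.dispY (D.black⁻¹ e))
    (sum_cycleFinset_facePerm_dispY T)

/-- The potentials develop the face boundary into the plane, up to the translation that puts the
starting point at the origin. -/
theorem facePos_eq_potential (T : D.TorusMarking) {p q : E → ℚ} (hp : D.IsPotential T.dispX p)
    (hq : D.IsPotential T.dispY q) (e : E) (k : ℕ) :
    ((D.facePos T.disp e k).1 : ℚ) = p ((D.facePerm ^ k) e) - p e ∧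
      ((D.facePos T.disp e k).2 : ℚ) = q ((D.facePerm ^ k) e) - q e := by
  induction k with
  | zero => simp [facePos]
  | succ k ih =>
    have h1 := hp ((D.facePerm ^ k) e)
    have h2 := hq ((D.facePerm ^ k) e)
    have h3 : (D.facePerm ^ (k + 1)) e = D.facePerm ((D.facePerm ^ k) e) := by
      rw [pow_succ', Equiv.Perm.mul_apply]
    unfold facePos at ih ⊢
    rw [Finset.sum_range_succ, h3]
    simp only [TorusMarking.dispX, TorusMarking.dispY] at h1 h2
    simp only [Prod.fst_add, Prod.snd_add, Prod.fst_sub, Prod.snd_sub, Int.cast_add, Int.cast_sub]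
    constructor
    · linarith [ih.1]
    · linarith [ih.2]

/-- The two components of the displacement have cup product one. -/
theorem cupForm_disp (T : D.TorusMarking) {p q : E → ℚ} (hp : D.IsPotential T.dispX p)
    (hq : D.IsPotential T.dispY q) : D.cupForm T.dispX p T.dispY q = 2 := by
  classical
  have key : ∀ e, (D.faceArea₂ T.disp e : ℚ) = ∑ e' ∈ cycleFinset D.facePerm e,
      (p e' * (T.dispY e' - T.dispY (D.black⁻¹ e')) - q e' * (T.dispX e' - T.dispX (D.black⁻¹ e')) -
        T.dispX e' * T.dispY (D.black⁻¹ e') + T.dispY e' * T.dispX (D.black⁻¹ e')) := fun e => by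
    -- The summand of `cupForm`, corrected for the starting point `(p e, q e)`; the corrections
    -- cancel around the face because its boundary is closed.
    let H : E → ℚ := fun e' => (p e' * (T.dispY e' - T.dispY (D.black⁻¹ e')) -
      q e' * (T.dispX e' - T.dispX (D.black⁻¹ e')) -
      T.dispX e' * T.dispY (D.black⁻¹ e') + T.dispY e' * T.dispX (D.black⁻¹ e')) -
      p e * (T.dispY e' - T.dispY (D.black⁻¹ e')) + q e * (T.dispX e' - T.dispX (D.black⁻¹ e'))
    have h1 : ∀ k, ((wedge (D.facePos T.disp e k)
          (D.facePos T.disp e k + T.disp ((D.facePerm ^ k) e)) +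
        wedge (D.facePos T.disp e k + T.disp ((D.facePerm ^ k) e))
          (D.facePos T.disp e (k + 1)) : ℤ) : ℚ) = H ((D.facePerm ^ k) e) := fun k => by
      obtain ⟨h2, h3⟩ := facePos_eq_potential T hp hq e k
      have h4 : D.facePos T.disp e (k + 1) = D.facePos T.disp e k +
          (T.disp ((D.facePerm ^ k) e) - T.disp (D.black⁻¹ ((D.facePerm ^ k) e))) := by
        rw [facePos, Finset.sum_range_succ, ← facePos]
      rw [h4]
      simp only [H, wedge, Prod.fst_add, Prod.snd_add, Prod.fst_sub, Prod.snd_sub,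
        TorusMarking.dispX, TorusMarking.dispY, Int.cast_add, Int.cast_sub, Int.cast_mul, h2, h3]
      ring
    rw [faceArea₂, Int.cast_sum, Finset.sum_congr rfl fun k _ => h1 k, sum_range_minimalPeriod]
    simp only [H]
    rw [Finset.sum_add_distrib, Finset.sum_sub_distrib, ← Finset.mul_sum, ← Finset.mul_sum,
      sum_cycleFinset_facePerm_dispX, sum_cycleFinset_facePerm_dispY]
    ring
  have hdeg := congrArg (Int.cast : ℤ → ℚ) T.degree_one
  rw [Int.cast_sum, Finset.sum_congr rfl fun f _ => key f.out] at hdeg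
  rw [cupForm, ← sum_sum_cycleFinset D.facePerm]
  convert hdeg using 1
  norm_num

open Classical in
/-- The matrix of the map that assigns to a 1-chain its boundary and its displacement. -/
def TorusMarking.boundaryMatrix (T : D.TorusMarking) : Matrix (D.Node ⊕ Bool) E ℚ
  | Sum.inl (Sum.inl w), e => if D.whiteEnd e = w then -1 else 0
  | Sum.inl (Sum.inr b), e => if D.blackEnd e = b then 1 else 0
  | Sum.inr false, e => T.dispX e
  | Sum.inr true, e => T.dispY e

open Classical in
theorem boundaryMatrix_mulVec_white (T : D.TorusMarking) (z : E → ℚ) (w : D.WhiteNode) :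
    T.boundaryMatrix.mulVec z (Sum.inl (Sum.inl w)) = -∑ e with D.whiteEnd e = w, z e := by
  simp [Matrix.mulVec, dotProduct, TorusMarking.boundaryMatrix, Finset.sum_filter,
    ← Finset.sum_neg_distrib, apply_ite]

open Classical in
theorem boundaryMatrix_mulVec_black (T : D.TorusMarking) (z : E → ℚ) (b : D.BlackNode) :
    T.boundaryMatrix.mulVec z (Sum.inl (Sum.inr b)) = ∑ e with D.blackEnd e = b, z e := by
  simp [Matrix.mulVec, dotProduct, TorusMarking.boundaryMatrix, Finset.sum_filter]

theorem boundaryMatrix_mulVec_false (T : D.TorusMarking) (z : E → ℚ) :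
    T.boundaryMatrix.mulVec z (Sum.inr false) = ∑ e, z e * T.dispX e := by
  simp [Matrix.mulVec, dotProduct, TorusMarking.boundaryMatrix, mul_comm]

theorem boundaryMatrix_mulVec_true (T : D.TorusMarking) (z : E → ℚ) :
    T.boundaryMatrix.mulVec z (Sum.inr true) = ∑ e, z e * T.dispY e := by
  simp [Matrix.mulVec, dotProduct, TorusMarking.boundaryMatrix, mul_comm]

open Classical in
theorem boundaryMatrix_vecMul (T : D.TorusMarking) (g : D.Node ⊕ Bool → ℚ) (e : E) :
    Matrix.vecMul g T.boundaryMatrix e =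
      g (Sum.inl (Sum.inr (D.blackEnd e))) - g (Sum.inl (Sum.inl (D.whiteEnd e))) +
        (g (Sum.inr false) * T.dispX e + g (Sum.inr true) * T.dispY e) := by
  simp [Matrix.vecMul, dotProduct, TorusMarking.boundaryMatrix, Fintype.sum_sum_type]
  ring

/-- The displacement and the boundary of an integral cycle. -/
theorem boundaryMatrix_mulVec_cycle (T : D.TorusMarking) {z : E → ℤ} (hz : D.IsCycle z) :
    T.boundaryMatrix.mulVec (fun e => (z e : ℚ)) =
      Sum.elim (fun _ => 0) fun i =>
        cond i ((∑ e, z e • T.disp e).2 : ℚ) ((∑ e, z e • T.disp e).1 : ℚ) := by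
  classical
  ext ((w | b) | (_ | _))
  · rw [boundaryMatrix_mulVec_white]
    have := hz.1 w
    rw [Sum.elim_inl, neg_eq_zero]
    exact_mod_cast this
  · rw [boundaryMatrix_mulVec_black]
    have := hz.2 b
    rw [Sum.elim_inl]
    exact_mod_cast this
  · rw [boundaryMatrix_mulVec_false]
    simp [Prod.fst_sum, TorusMarking.dispX]
  · rw [boundaryMatrix_mulVec_true]
    simp [Prod.snd_sum, TorusMarking.dispY]

/-- Rational version of the injectivity of the map from homology to `ℤ²`. -/
theorem mem_range_faceBoundary (T : D.TorusMarking) {z : E → ℚ}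
    (hz : T.boundaryMatrix.mulVec z = 0) : ∃ c, D.faceBoundary c = z := by
  classical
  -- A common denominator `b` reduces the claim to integral cycles.
  obtain ⟨b, hb⟩ := IsLocalization.exist_integer_multiples_of_finite (nonZeroDivisors ℤ) z
  choose z' hz' using hb
  have hb0 : ((b : ℤ) : ℚ) ≠ 0 := by
    exact_mod_cast nonZeroDivisors.ne_zero b.2
  have hzz : ∀ e, (z' e : ℚ) = (b : ℤ) * z e := fun e => by
    have := hz' e
    simpa using this
  have hcyc : D.IsCycle z' := by
    constructor
    · intro w
      have h := congrFun hz (Sum.inl (Sum.inl w))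
      rw [boundaryMatrix_mulVec_white, Pi.zero_apply, neg_eq_zero] at h
      have : ((∑ e with D.whiteEnd e = w, z' e : ℤ) : ℚ) = 0 := by
        rw [Int.cast_sum, Finset.sum_congr rfl fun e _ => hzz e, ← Finset.mul_sum, h, mul_zero]
      exact_mod_cast this
    · intro w
      have h := congrFun hz (Sum.inl (Sum.inr w))
      rw [boundaryMatrix_mulVec_black, Pi.zero_apply] at h
      have : ((∑ e with D.blackEnd e = w, z' e : ℤ) : ℚ) = 0 := by
        rw [Int.cast_sum, Finset.sum_congr rfl fun e _ => hzz e, ← Finset.mul_sum, h, mul_zero]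
      exact_mod_cast this
  have hdisp : ∑ e, z' e • T.disp e = 0 := by
    have h1 := boundaryMatrix_mulVec_cycle T hcyc
    have h2 : T.boundaryMatrix.mulVec (fun e => (z' e : ℚ)) = 0 := by
      have : (fun e => (z' e : ℚ)) = ((b : ℤ) : ℚ) • z := funext hzz
      rw [this, Matrix.mulVec_smul, hz, smul_zero]
    rw [h2] at h1
    ext
    · have := congrFun h1 (Sum.inr false)
      simp only [Pi.zero_apply, Sum.elim_inr, cond_false] at this
      exact_mod_cast this.symm
    · have := congrFun h1 (Sum.inr true)
      simp only [Pi.zero_apply, Sum.elim_inr, cond_true] at this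
      exact_mod_cast this.symm
  obtain ⟨c, hc⟩ := T.homology_injective z' hcyc hdisp
  refine ⟨fun f => c f / (b : ℤ), funext fun e => ?_⟩
  rw [faceBoundary_apply, ← sub_div, div_eq_iff hb0, mul_comm, ← hzz, hc]
  push_cast
  rfl

/-- A chain that is the boundary of faces pairs to zero with a cochain that has a potential. -/
theorem faceBoundary_dotProduct_eq_zero {x p : E → ℚ} (hp : D.IsPotential x p) (c : D.Face → ℚ) :
    D.faceBoundary c ⬝ᵥ x = 0 := by
  unfold dotProduct
  rw [← Finset.sum_const_zero (ι := E) (s := Finset.univ)]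
  refine sum_eq_of_telescoping D.facePerm D.black⁻¹ (fun e => c (D.leftFace e) * p e)
    (fun e => c (D.rightFace e) * x e) fun e => ?_
  have h1 : D.rightFace (D.black⁻¹ e) = D.leftFace e := by
    rw [← leftFace_white_inv, ← facePerm_apply, leftFace_facePerm]
  have h2 := hp e
  rw [faceBoundary_apply, leftFace_facePerm, h1]
  linear_combination (-c (D.leftFace e)) * h2

theorem sum_filter_sub_comp_eq_zero {M N : Type*} [AddCommGroup M] [DecidableEq N]
    (σ : Equiv.Perm E) (π : E → N) (hπ : ∀ e, π (σ e) = π e) (u : E → M) (n : N) :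
    ∑ e with π e = n, (u (σ e) - u e) = 0 := by
  rw [Finset.sum_filter]
  refine (Finset.sum_congr rfl fun e _ => ?_).trans
    (sum_comp_sub_eq_zero σ fun e => if π e = n then u e else 0)
  rw [hπ]
  split_ifs <;> simp

/-- A boundary has no boundary, and it has no displacement because faces lift to closed polygons. -/
theorem boundaryMatrix_mulVec_faceBoundary (T : D.TorusMarking) (c : D.Face → ℚ) :
    T.boundaryMatrix.mulVec (D.faceBoundary c) = 0 := by
  classical
  obtain ⟨p, hp⟩ := exists_isPotential_dispX T
  obtain ⟨q, hq⟩ := exists_isPotential_dispY T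
  ext ((w | b) | (_ | _))
  · rw [boundaryMatrix_mulVec_white, Pi.zero_apply, neg_eq_zero,
      ← sum_filter_sub_comp_eq_zero D.white⁻¹ D.whiteEnd whiteEnd_white_inv
        (fun e => -c (D.leftFace e)) w]
    refine Finset.sum_congr rfl fun e _ => ?_
    rw [faceBoundary_apply, leftFace_white_inv]
    ring
  · rw [boundaryMatrix_mulVec_black, Pi.zero_apply,
      ← sum_filter_sub_comp_eq_zero D.black D.blackEnd blackEnd_black
        (fun e => -c (D.leftFace e)) b]
    refine Finset.sum_congr rfl fun e _ => ?_
    have : D.rightFace e = D.leftFace (D.black e) := rfl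
    rw [faceBoundary_apply, this]
    ring
  · rw [boundaryMatrix_mulVec_false]
    exact faceBoundary_dotProduct_eq_zero hp c
  · rw [boundaryMatrix_mulVec_true]
    exact faceBoundary_dotProduct_eq_zero hq c

/-- The chain is a difference both along `white⁻¹` and along `black⁻¹`, so it telescopes around
every node. -/
theorem isCycle_zigzagChain (Z : D.Zigzag) : D.IsCycle (zigzagChain Z) := by
  classical
  constructor
  · intro w
    rw [← sum_filter_sub_comp_eq_zero D.white⁻¹ D.whiteEnd whiteEnd_white_inv (onZigzag Z) w]
    rfl
  · intro b
    rw [← sum_filter_sub_comp_eq_zero D.black⁻¹ D.blackEnd blackEnd_black_inv (onZigzag Z) b]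
    refine Finset.sum_congr ?_ fun e _ => ?_
    · congr!
    · rw [zigzagChain, onZigzag_white_inv]

theorem sum_zigzagChain_disp (T : D.TorusMarking) (Z : D.Zigzag) :
    ∑ e, zigzagChain Z e • T.disp e = T.winding Z := by
  classical
  unfold TorusMarking.winding
  rw [Finset.sum_filter, ← sub_eq_zero, ← Finset.sum_sub_distrib]
  refine (Finset.sum_congr rfl fun e _ => ?_).trans
    (sum_comp_sub_eq_zero D.white⁻¹ fun e => onZigzag Z e • T.disp (D.white e))
  rw [perm_apply_inv]
  simp only [zigzagChain, sub_smul]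
  have : (if D.zigzagOf e = Z then T.disp (D.white e) - T.disp e else 0) =
      onZigzag Z e • T.disp (D.white e) - onZigzag Z e • T.disp e := by
    unfold onZigzag
    split_ifs <;> simp
  rw [this]
  abel

/-- Poincaré duality: the crossings of a cycle with a zigzag path are counted by the wedge product
of the winding numbers. -/
theorem sum_mul_zigzagCochain (T : D.TorusMarking) (Z : D.Zigzag) {z : E → ℤ} (hz : D.IsCycle z) :
    ∑ e, z e * zigzagCochain Z e = wedge (∑ e, z e • T.disp e) (T.winding Z) := by
  classical
  obtain ⟨p, hp⟩ := exists_isPotential_dispX T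
  obtain ⟨q, hq⟩ := exists_isPotential_dispY T
  have hη := isPotential_zigzagCochain Z
  -- The crossing cochain vanishes on boundaries, hence on the kernel of the boundary matrix. So it
  -- is a coboundary plus `α • T.dispX + β • T.dispY`.
  obtain ⟨g, hg⟩ := exists_vecMul_eq_of_orthogonal T.boundaryMatrix
    (fun e => (zigzagCochain Z e : ℚ)) fun z hz => by
      obtain ⟨c, rfl⟩ := mem_range_faceBoundary T hz
      exact faceBoundary_dotProduct_eq_zero hη c
  set α := g (Sum.inr false) with hα
  set β := g (Sum.inr true) with hβ
  let γ : E → ℚ := fun e => g (Sum.inl (Sum.inl (D.whiteEnd e)))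
  let κ : E → ℚ := fun e => g (Sum.inl (Sum.inr (D.blackEnd e)))
  have hγ : ∀ e, γ (D.white⁻¹ e) = γ e := fun e => by simp only [γ, whiteEnd_white_inv]
  have hκ : ∀ e, κ (D.black⁻¹ e) = κ e := fun e => by simp only [κ, blackEnd_black_inv]
  have hdec : (fun e => (zigzagCochain Z e : ℚ)) = (κ - γ) + (α • T.dispX + β • T.dispY) := by
    rw [← hg]
    ext e
    rw [boundaryMatrix_vecMul]
    rfl
  have hpot : D.IsPotential (fun e => (zigzagCochain Z e : ℚ)) (γ + (α • p + β • q)) := by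
    rw [hdec]
    exact (isPotential_coboundary hγ hκ).add ((hp.smul α).add (hq.smul β))
  have hform : ∀ {y r : E → ℚ}, D.IsPotential y r → 2 * ∑ e, (zigzagChain Z e : ℚ) * y e =
      α * D.cupForm T.dispX p y r + β * D.cupForm T.dispY q y r := fun hr => by
    rw [← cupForm_zigzagCochain Z hr, cupForm_eq_of_isPotential hη hpot hr, hdec,
      cupForm_add_left, cupForm_coboundary hγ hκ hr, cupForm_add_left, cupForm_smul_left,
      cupForm_smul_left, zero_add]
  -- Cupping with the two coordinate cochains, whose product is known, identifies `α` and `β` with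
  -- the components of the winding number, up to order and sign.
  have hx := hform hp
  have hy := hform hq
  rw [cupForm_self, cupForm_swap, cupForm_disp T hp hq] at hx
  rw [cupForm_self, cupForm_disp T hp hq] at hy
  have hW := boundaryMatrix_mulVec_cycle T (isCycle_zigzagChain Z)
  have hW1 := congrFun hW (Sum.inr false)
  have hW2 := congrFun hW (Sum.inr true)
  rw [boundaryMatrix_mulVec_false, sum_zigzagChain_disp] at hW1
  rw [boundaryMatrix_mulVec_true, sum_zigzagChain_disp] at hW2
  simp only [Sum.elim_inr, cond_false, cond_true] at hW1 hW2
  have hpair : ∑ e, (z e : ℚ) * zigzagCochain Z e =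
      α * (∑ e, z e • T.disp e).1 + β * (∑ e, z e • T.disp e).2 := by
    have h1 : ∑ e, (z e : ℚ) * zigzagCochain Z e =
        Matrix.vecMul g T.boundaryMatrix ⬝ᵥ fun e => (z e : ℚ) := by
      rw [hg, dotProduct]
      exact Finset.sum_congr rfl fun e _ => mul_comm _ _
    rw [h1, ← Matrix.dotProduct_mulVec, boundaryMatrix_mulVec_cycle T hz]
    simp [dotProduct, Fintype.sum_sum_type]
    ring
  have hfin : ((∑ e, z e * zigzagCochain Z e : ℤ) : ℚ) =
      (wedge (∑ e, z e • T.disp e) (T.winding Z) : ℤ) := by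
    push_cast [wedge]
    rw [hpair]
    have ha : α = (T.winding Z).2 := by linarith
    have hb : β = -(T.winding Z).1 := by linarith
    rw [ha, hb]
    ring
  exact_mod_cast hfin

/-- The intersection number of two zigzag paths. -/
theorem sum_crossings (T : D.TorusMarking) (Z Z' : D.Zigzag) :
    ∑ e, (onZigzag Z e * onZigzag Z' (D.white⁻¹ e) - onZigzag Z' e * onZigzag Z (D.white⁻¹ e)) =
      wedge (T.winding Z') (T.winding Z) := by
  rw [← sum_zigzagChain_disp T Z', ← sum_mul_zigzagCochain T Z (isCycle_zigzagChain Z'),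
    ← sub_eq_zero, ← Finset.sum_sub_distrib,
    ← sum_comp_sub_eq_zero D.white⁻¹ fun e => -(onZigzag Z' e * onZigzag Z e)]
  refine Finset.sum_congr rfl fun e _ => ?_
  simp only [zigzagChain, zigzagCochain]
  ring

theorem sum_winding (T : D.TorusMarking) [Fintype D.Zigzag] : ∑ Z, T.winding Z = 0 := by
  classical
  unfold TorusMarking.winding
  rw [Finset.sum_fiberwise (s := Finset.univ) (g := D.zigzagOf)]
  exact sum_comp_sub_eq_zero D.white T.disp

end BipartiteMap

/-! ### Euler's formula. -/

namespace BipartiteMap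

variable {E : Type*} [Fintype E] {D : BipartiteMap E}

/-- A 2-chain without boundary has equal values on the two sides of every edge, so connectedness
makes it constant. -/
theorem finrank_ker_faceBoundary (hconn : D.graph.Connected) :
    Module.finrank ℚ (LinearMap.ker D.faceBoundary) = 1 := by
  obtain ⟨e₀⟩ := nonempty_edge hconn
  have hker : LinearMap.ker D.faceBoundary = Submodule.span ℚ {fun _ => (1 : ℚ)} := by
    ext c
    rw [LinearMap.mem_ker, Submodule.mem_span_singleton]
    constructor
    · intro h
      have hc : ∀ e, c (D.leftFace e) = c (D.rightFace e) := fun e => by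
        have := congrFun h e
        rw [faceBoundary_apply] at this
        exact sub_eq_zero.1 this
      have hall : ∀ e, c (D.leftFace e) = c (D.leftFace e₀) := by
        refine edge_induction hconn (e := e₀) (fun e he => ?_) (fun e he => ?_) rfl
        · rw [hc, ← leftFace_white_inv, perm_inv_apply, he]
        · exact (hc e).symm.trans he
      refine ⟨c (D.leftFace e₀), funext fun f => ?_⟩
      obtain ⟨e, rfl⟩ := exists_leftFace_eq f
      simp [hall e]
    · rintro ⟨a, rfl⟩
      ext e
      simp [faceBoundary_apply]
  rw [hker]
  exact finrank_span_singleton fun h => one_ne_zero (congrFun h (D.leftFace e₀))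

open Classical in
-- Pairing a relation between the rows with cycles of displacement (1, 0) and (0, 1) kills its last
-- two coefficients. What is left is a function on the nodes without coboundary, a constant.
theorem finrank_ker_transpose_boundaryMatrix (T : D.TorusMarking) (hconn : D.graph.Connected) :
    Module.finrank ℚ (LinearMap.ker T.boundaryMatrix.transpose.mulVecLin) = 1 := by
  obtain ⟨e₀⟩ := nonempty_edge hconn
  have hker : LinearMap.ker T.boundaryMatrix.transpose.mulVecLin =
      Submodule.span ℚ {(Sum.elim (fun _ => 1) fun _ => 0 : D.Node ⊕ Bool → ℚ)} := by
    ext g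
    rw [LinearMap.mem_ker, Submodule.mem_span_singleton, Matrix.mulVecLin_apply,
      Matrix.mulVec_transpose]
    constructor
    · intro h
      have hpair : ∀ z : E → ℤ, D.IsCycle z → g (Sum.inr false) * (∑ e, z e • T.disp e).1 +
          g (Sum.inr true) * (∑ e, z e • T.disp e).2 = 0 := fun z hz => by
        have h1 := Matrix.dotProduct_mulVec g T.boundaryMatrix fun e => (z e : ℚ)
        rw [h, zero_dotProduct, boundaryMatrix_mulVec_cycle T hz] at h1
        rw [← h1]
        simp [dotProduct, Fintype.sum_sum_type]
        ring
      obtain ⟨z₁, hz₁, h₁⟩ := T.homology_surjective (1, 0)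
      obtain ⟨z₂, hz₂, h₂⟩ := T.homology_surjective (0, 1)
      have hα : g (Sum.inr false) = 0 := by
        have := hpair z₁ hz₁
        rw [h₁] at this
        simpa using this
      have hβ : g (Sum.inr true) = 0 := by
        have := hpair z₂ hz₂
        rw [h₂] at this
        simpa using this
      have hg : ∀ e, g (Sum.inl (Sum.inr (D.blackEnd e))) =
          g (Sum.inl (Sum.inl (D.whiteEnd e))) := fun e => by
        have := congrFun h e
        rw [boundaryMatrix_vecMul, hα, hβ, Pi.zero_apply] at this
        linarith
      have hall : ∀ e, g (Sum.inl (Sum.inl (D.whiteEnd e))) =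
          g (Sum.inl (Sum.inl (D.whiteEnd e₀))) := by
        refine edge_induction hconn (e := e₀) (fun e he => ?_) (fun e he => ?_) rfl
        · rw [whiteEnd_white, he]
        · rw [← hg, blackEnd_black, hg, he]
      refine ⟨g (Sum.inl (Sum.inl (D.whiteEnd e₀))), funext ?_⟩
      rintro ((w | b) | (_ | _))
      · obtain ⟨e, rfl⟩ := exists_whiteEnd_eq w
        simp [hall e]
      · obtain ⟨e, rfl⟩ := exists_blackEnd_eq b
        simp [hg e, hall e]
      · simp [hα]
      · simp [hβ]
    · rintro ⟨a, rfl⟩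
      ext e
      rw [boundaryMatrix_vecMul]
      simp
  rw [hker]
  exact finrank_span_singleton fun h =>
    one_ne_zero (congrFun h (Sum.inl (Sum.inl (D.whiteEnd e₀))))

/-- Euler's formula for the torus. -/
theorem card_edge_eq (T : D.TorusMarking) (hconn : D.graph.Connected) :
    Fintype.card E = Nat.card D.WhiteNode + Nat.card D.BlackNode + D.numFaces := by
  classical
  -- With F faces, N nodes and ρ the rank of the boundary matrix, the three rank formulas and
  -- exactness give `Fintype.card E` = ρ + (F - 1) and N + 2 = ρ + 1.
  have h1 := LinearMap.finrank_range_add_finrank_ker D.faceBoundary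
  have h2 := LinearMap.finrank_range_add_finrank_ker T.boundaryMatrix.mulVecLin
  have h3 := LinearMap.finrank_range_add_finrank_ker T.boundaryMatrix.transpose.mulVecLin
  have h4 : LinearMap.ker T.boundaryMatrix.mulVecLin = LinearMap.range D.faceBoundary := by
    ext z
    rw [LinearMap.mem_ker, Matrix.mulVecLin_apply, LinearMap.mem_range]
    constructor
    · exact mem_range_faceBoundary T
    · rintro ⟨c, rfl⟩
      exact boundaryMatrix_mulVec_faceBoundary T c
  have h5 := Matrix.rank_transpose T.boundaryMatrix
  unfold Matrix.rank at h5
  rw [finrank_ker_faceBoundary hconn, Module.finrank_fintype_fun_eq_card] at h1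
  rw [h4, Module.finrank_fintype_fun_eq_card] at h2
  rw [finrank_ker_transpose_boundaryMatrix T hconn, Module.finrank_fintype_fun_eq_card,
    Fintype.card_sum, Fintype.card_sum, Fintype.card_bool] at h3
  rw [numFaces, Nat.card_eq_fintype_card, Nat.card_eq_fintype_card, Nat.card_eq_fintype_card]
  omega

/-! ### Twice the area as a sum of signs over the edges. -/

/-- The step across an edge `e` starts at `white⁻¹ e` or `black⁻¹ e`, and these lie on the same
zigzag path. -/
theorem sum_stepSign_white_eq (D : BipartiteMap E) (θ : D.Zigzag → ℝ) :
    ∑ e, stepSign D.white (fun e => θ (D.zigzagOf e)) e =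
      ∑ e, stepSign D.black (fun e => θ (D.zigzagOf e)) e := by
  rw [← Equiv.sum_comp D.white⁻¹, ← Equiv.sum_comp D.black⁻¹ (stepSign D.black _)]
  refine Finset.sum_congr rfl fun e _ => ?_
  rw [stepSign, stepSign, perm_apply_inv, perm_apply_inv, zigzagOf_white_inv]

open Classical in
/-- Every edge is a crossing of two zigzag paths, so wedge products of winding numbers can be summed
edge by edge. -/
theorem sum_wedge_eq_sum_stepSign (T : D.TorusMarking) (θ : D.Zigzag → ℝ) :
    ∑ Z, ∑ Z' with θ Z' < θ Z, wedge (T.winding Z') (T.winding Z) =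
      ∑ e, stepSign D.white (fun e => θ (D.zigzagOf e)) e := by
  -- Of all pairs of paths, an edge sees only the two that cross on it.
  have hpt : ∀ a b : D.Zigzag, (∑ Z, ∑ Z' with θ Z' < θ Z,
      (if a = Z then (1 : ℤ) else 0) * (if b = Z' then 1 else 0)) = if θ b < θ a then 1 else 0 := by
    intro a b
    simp_rw [Finset.sum_filter]
    rw [Finset.sum_eq_single a (by
      intro Z _ hZ
      simp [hZ.symm]) (by simp), Finset.sum_eq_single b (by
      intro Z _ hZ
      simp [hZ.symm]) (by simp)]
    simp
  have hpt' : ∀ a b : D.Zigzag, (∑ Z, ∑ Z' with θ Z' < θ Z,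
      (if b = Z' then (1 : ℤ) else 0) * (if a = Z then 1 else 0)) = if θ b < θ a then 1 else 0 := by
    intro a b
    rw [← hpt a b]
    exact Finset.sum_congr rfl fun _ _ => Finset.sum_congr rfl fun _ _ => mul_comm _ _
  rw [← Equiv.sum_comp D.white⁻¹]
  calc ∑ Z, ∑ Z' with θ Z' < θ Z, wedge (T.winding Z') (T.winding Z)
      = ∑ Z, ∑ Z' with θ Z' < θ Z, ∑ e, (onZigzag Z e * onZigzag Z' (D.white⁻¹ e) -
          onZigzag Z' e * onZigzag Z (D.white⁻¹ e)) :=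
        Finset.sum_congr rfl fun Z _ => Finset.sum_congr rfl fun Z' _ =>
          (sum_crossings T Z Z').symm
    _ = ∑ e, ∑ Z, ∑ Z' with θ Z' < θ Z, (onZigzag Z e * onZigzag Z' (D.white⁻¹ e) -
          onZigzag Z' e * onZigzag Z (D.white⁻¹ e)) := by
        rw [Finset.sum_comm]
        exact Finset.sum_congr rfl fun Z _ => Finset.sum_comm
    _ = _ := by
        refine Finset.sum_congr rfl fun e _ => ?_
        simp_rw [Finset.sum_sub_distrib]
        unfold onZigzag
        rw [hpt, hpt']
        rcases lt_trichotomy (θ (D.zigzagOf (D.white⁻¹ e))) (θ (D.zigzagOf e)) with h | h | h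
        · rw [stepSign_of_lt (by rwa [perm_apply_inv]), if_pos h, if_neg h.le.not_gt, sub_zero]
        · rw [stepSign_eq_zero.2 (by rw [perm_apply_inv, h]), h, sub_self]
        · rw [stepSign_of_gt (by rwa [perm_apply_inv]), if_neg h.le.not_gt, if_pos h, zero_sub]

/-- Twice the area of the polygon, as a sum over the edges; the position of the zigzag paths with
winding zero in the order of directions is arbitrary. -/
theorem two_mul_zigzagArea (T : D.TorusMarking) (θ : D.Zigzag → ℝ)
    (hθ : ∀ Z, T.winding Z ≠ 0 → θ Z = vecArg (T.winding Z)) :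
    2 * T.zigzagArea = ((∑ e, stepSign D.white (fun e => θ (D.zigzagOf e)) e : ℤ) : ℝ) := by
  classical
  unfold TorusMarking.zigzagArea
  rw [volume_legPolygon T.winding (sum_winding T), ← sum_wedge_eq_sum_stepSign T θ]
  congr 1
  refine Finset.sum_congr rfl fun Z _ => ?_
  rw [Finset.sum_filter, Finset.sum_filter]
  refine Finset.sum_congr rfl fun Z' _ => ?_
  by_cases h : T.winding Z = 0
  · simp [h, wedge]
  by_cases h' : T.winding Z' = 0
  · simp [h', wedge]
  rw [hθ Z h, hθ Z' h']

/-! ### Proper order at the nodes and the extremal case. -/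

theorem valence_ne_one_iff : (∀ v : D.Node, D.valence v ≠ 1) ↔
    (∀ e, D.white e ≠ e) ∧ ∀ e, D.black e ≠ e := by
  have hcard : ∀ (f : Equiv.Perm E) (e : E), Nat.card {x // f.SameCycle x e} = 1 ↔ f e = e := by
    intro f e
    rw [← Function.IsFixedPt, ← Function.minimalPeriod_eq_one_iff_isFixedPt, ← card_cycleFinset,
      ← Nat.card_eq_finsetCard]
    have : Nat.card {x // f.SameCycle x e} = Nat.card (cycleFinset f e) :=
      Nat.card_congr (Equiv.subtypeEquivRight fun x => by
        rw [mem_cycleFinset, Equiv.Perm.sameCycle_comm])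
    rw [this]
  have hw : ∀ e, D.valence (Sum.inl (D.whiteEnd e)) = 1 ↔ D.white e = e := fun e => by
    rw [← hcard D.white e, valence]
    simp only [whiteEnd_eq_iff]
  have hb : ∀ e, D.valence (Sum.inr (D.blackEnd e)) = 1 ↔ D.black e = e := fun e => by
    rw [← hcard D.black e, valence]
    simp only [blackEnd_eq_iff]
  constructor
  · exact fun h => ⟨fun e he => h _ ((hw e).2 he), fun e he => h _ ((hb e).2 he)⟩
  · rintro ⟨h1, h2⟩ (w | b) hv
    · obtain ⟨e, rfl⟩ := exists_whiteEnd_eq w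
      exact h1 e ((hw e).1 hv)
    · obtain ⟨e, rfl⟩ := exists_blackEnd_eq b
      exact h2 e ((hb e).1 hv)

theorem properlyOrdered_iff (T : D.TorusMarking) : T.ProperlyOrdered ↔
    (∀ e, T.OrderedAt D.white e) ∧ ∀ e, T.OrderedAt D.black e := by
  constructor
  · exact fun h => ⟨fun e => h (Sum.inl (D.whiteEnd e)) e rfl,
      fun e => h (Sum.inr (D.blackEnd e)) e rfl⟩
  · rintro ⟨h1, h2⟩ (w | b)
    · exact fun e _ => h1 e
    · exact fun e _ => h2 e

/-- The sum of the signs at a properly ordered node of valence `n` is `n - 2`. -/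
theorem TorusMarking.OrderedAt.sum_stepSign {T : D.TorusMarking} {rot : Equiv.Perm E} {e : E}
    (h : T.OrderedAt rot e) : rot e ≠ e ∧
      ∑ e' ∈ cycleFinset rot e, stepSign rot (fun e => vecArg (T.winding (D.zigzagOf e))) e' =
        (cycleFinset rot e).card - 2 := by
  obtain ⟨-, h1, h2⟩ := h
  obtain ⟨m, hem, hm⟩ := exists_increasesFrom_of_circular h1 h2
  have hfix : ∀ e', rot.SameCycle e e' → rot e' ≠ e' := fun e' he' h => h1 e' he' (by rw [h])
  refine ⟨hfix e (Equiv.Perm.SameCycle.refl _ _), ?_⟩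
  rw [cycleFinset_eq hem]
  exact sum_stepSign_of_increasesFrom (hfix m hem) hm

/-- The nonzero sign at `e` rules out the constant node of valence two, the only other extremal
case. -/
theorem orderedAt_of_sum_stepSign {T : D.TorusMarking} {rot : Equiv.Perm E}
    (hfix : ∀ e, rot e ≠ e) (hne : ∀ Z, T.winding Z ≠ 0) {e : E}
    (hsum : ∑ e' ∈ cycleFinset rot e,
      stepSign rot (fun e => vecArg (T.winding (D.zigzagOf e))) e' = (cycleFinset rot e).card - 2)
    (hstep : stepSign rot (fun e => vecArg (T.winding (D.zigzagOf e))) e ≠ 0) :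
    T.OrderedAt rot e := by
  rcases increasesFrom_of_sum_stepSign_eq (hfix e) hsum with ⟨m, hem, hm⟩ | ⟨h, -⟩
  · refine ⟨fun e' _ => hne _, fun e' he' h => ?_, fun e' he' i j hi hij hj => ?_⟩
    · rw [vecDir_eq_iff] at h
      exact hm.apply_ne (hem.symm.trans he') (hfix e') h
    · exact hm.circular (W := fun e => T.winding (D.zigzagOf e)) (hem.symm.trans he') hi hij hj
  · exact absurd (h e (mem_cycleFinset.2 (Equiv.Perm.SameCycle.refl _ _))) hstep

/-- If the sum of signs around a cycle is extremal, a vanishing sign propagates to the whole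
cycle. -/
theorem stepSign_eq_zero_of_sameCycle {rot : Equiv.Perm E} {θ : E → ℝ} (hfix : ∀ e, rot e ≠ e)
    {e : E} (hsum : ∑ e' ∈ cycleFinset rot e, stepSign rot θ e' = (cycleFinset rot e).card - 2)
    (he : stepSign rot θ e = 0) {e' : E} (hee' : rot.SameCycle e e') : stepSign rot θ e' = 0 := by
  rcases increasesFrom_of_sum_stepSign_eq (hfix e) hsum with ⟨m, hem, hm⟩ | ⟨h, -⟩
  · exact absurd (stepSign_eq_zero.1 he).symm (hm.apply_ne hem.symm (hfix e))
  · exact h e' (mem_cycleFinset.2 hee')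

/-- The white and black bounds for the same sum have the mean `D.numFaces`, by Euler's formula. If
the sum equals this mean, both bounds are attained, and so is the bound at every node. -/
theorem sum_stepSign_of_numFaces_eq {T : D.TorusMarking} (hconn : D.graph.Connected)
    (hw : ∀ e, D.white e ≠ e) (hb : ∀ e, D.black e ≠ e)
    (harea : (D.numFaces : ℝ) = 2 * T.zigzagArea) {θ : D.Zigzag → ℝ}
    (hθ : ∀ Z, T.winding Z ≠ 0 → θ Z = vecArg (T.winding Z)) :
    (∑ e, stepSign D.white (fun e => θ (D.zigzagOf e)) e = D.numFaces) ∧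
    (∀ e, ∑ e' ∈ cycleFinset D.white e, stepSign D.white (fun e => θ (D.zigzagOf e)) e' =
      (cycleFinset D.white e).card - 2) ∧
    (∀ e, ∑ e' ∈ cycleFinset D.black e, stepSign D.black (fun e => θ (D.zigzagOf e)) e' =
      (cycleFinset D.black e).card - 2) := by
  have h1 : ∑ e, stepSign D.white (fun e => θ (D.zigzagOf e)) e = D.numFaces := by
    rw [two_mul_zigzagArea T θ hθ] at harea
    exact_mod_cast harea.symm
  have h2 := sum_stepSign_univ_le (fun e => θ (D.zigzagOf e)) hw
  have h3 := sum_stepSign_univ_le (fun e => θ (D.zigzagOf e)) hb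
  have h4 := card_edge_eq T hconn
  have h5 := sum_stepSign_white_eq D θ
  refine ⟨h1, (sum_stepSign_univ_eq_iff _ hw).1 ?_, (sum_stepSign_univ_eq_iff _ hb).1 ?_⟩ <;>
  · rw [h4] at h2 h3 ⊢
    push_cast at h2 h3 ⊢
    linarith

/-- In the extremal case no edge is the crossing of two zigzag paths at the same position. -/
theorem position_ne_of_numFaces_eq {T : D.TorusMarking} (hconn : D.graph.Connected)
    (hw : ∀ e, D.white e ≠ e) (hb : ∀ e, D.black e ≠ e)
    (harea : (D.numFaces : ℝ) = 2 * T.zigzagArea) {θ : D.Zigzag → ℝ}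
    (hθ : ∀ Z, T.winding Z ≠ 0 → θ Z = vecArg (T.winding Z)) (e : E) :
    θ (D.zigzagOf e) ≠ θ (D.zigzagOf (D.white⁻¹ e)) := by
  obtain ⟨hF, hsw, hsb⟩ := sum_stepSign_of_numFaces_eq hconn hw hb harea hθ
  intro he
  have hall : ∀ e', θ (D.zigzagOf e') = θ (D.zigzagOf (D.white⁻¹ e')) := by
    refine edge_induction hconn (e := e) (fun x hx => ?_) (fun x hx => ?_) he
    · have h0 : stepSign D.white (fun e => θ (D.zigzagOf e)) (D.white⁻¹ x) = 0 :=
        stepSign_eq_zero.2 (by rw [perm_apply_inv, hx])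
      have := stepSign_eq_zero_of_sameCycle hw (hsw _) h0 (e' := x)
        ⟨1, by rw [zpow_one, perm_apply_inv]⟩
      rw [perm_inv_apply]
      exact stepSign_eq_zero.1 this
    · have h0 : stepSign D.black (fun e => θ (D.zigzagOf e)) (D.black⁻¹ x) = 0 :=
        stepSign_eq_zero.2 (by rw [perm_apply_inv, hx, zigzagOf_white_inv])
      have := stepSign_eq_zero_of_sameCycle hb (hsb _) h0 (e' := x)
        ⟨1, by rw [zpow_one, perm_apply_inv]⟩
      rw [zigzagOf_white_inv, perm_inv_apply]
      exact stepSign_eq_zero.1 this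
  rw [Finset.sum_eq_zero fun x _ => stepSign_eq_zero.2 (by
    rw [hall (D.white x), perm_inv_apply])] at hF
  have : Nonempty D.Face := ⟨D.leftFace e⟩
  have hpos : 0 < D.numFaces := by
    unfold numFaces
    exact Nat.card_pos
  omega

theorem winding_ne_zero_of_numFaces_eq {T : D.TorusMarking} (hconn : D.graph.Connected)
    (hw : ∀ e, D.white e ≠ e) (hb : ∀ e, D.black e ≠ e)
    (harea : (D.numFaces : ℝ) = 2 * T.zigzagArea) (Z : D.Zigzag) : T.winding Z ≠ 0 := by
  classical
  intro h0
  obtain ⟨e, rfl⟩ : ∃ e, D.zigzagOf e = Z := Quotient.exists_rep Z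
  set Z' := D.zigzagOf (D.white⁻¹ e) with hZ'
  -- All paths of winding zero are placed at the position of `Z'`, which crosses `Z` on `e`; this
  -- remains consistent if `Z'` itself has winding zero.
  let θ : D.Zigzag → ℝ := fun Y => if T.winding Y = 0 then vecArg (T.winding Z') else
    vecArg (T.winding Y)
  refine position_ne_of_numFaces_eq (θ := θ) hconn hw hb harea (fun Y hY => if_neg hY) e ?_
  simp only [θ, h0, if_true, ← hZ', ite_self]

end BipartiteMap

end

/-! ### The theorem. -/

open BipartiteMap

theorem mainTheorem1 {E : Type*} [Fintype E] (D : BipartiteMap E) (T : D.TorusMarking)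
    (hconn : D.graph.Connected) :
    T.ProperlyOrdered ↔
      (∀ v : D.Node, D.valence v ≠ 1) ∧ (D.numFaces : ℝ) = 2 * T.zigzagArea := by
  rw [properlyOrdered_iff, valence_ne_one_iff]
  constructor
  · rintro ⟨hw, hb⟩
    have hfw : ∀ e, D.white e ≠ e := fun e => (hw e).sum_stepSign.1
    have hfb : ∀ e, D.black e ≠ e := fun e => (hb e).sum_stepSign.1
    refine ⟨⟨hfw, hfb⟩, ?_⟩
    have h1 := (sum_stepSign_univ_eq_iff _ hfw).2 fun e => (hw e).sum_stepSign.2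
    have h2 := (sum_stepSign_univ_eq_iff _ hfb).2 fun e => (hb e).sum_stepSign.2
    have h3 := sum_stepSign_white_eq D fun Z => vecArg (T.winding Z)
    have h4 := card_edge_eq T hconn
    rw [two_mul_zigzagArea T (fun Z => vecArg (T.winding Z)) fun _ _ => rfl]
    -- At properly ordered nodes both bounds are equalities; their mean is the number of faces.
    have h5 : ∑ e, stepSign D.white (fun e => vecArg (T.winding (D.zigzagOf e))) e =
        D.numFaces := by
      rw [h4] at h1 h2
      push_cast at h1 h2
      linarith
    rw [h5, Int.cast_natCast]
  · rintro ⟨⟨hfw, hfb⟩, harea⟩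
    have hne := winding_ne_zero_of_numFaces_eq hconn hfw hfb harea
    have hadm : ∀ Z, T.winding Z ≠ 0 → vecArg (T.winding Z) = vecArg (T.winding Z) :=
      fun _ _ => rfl
    obtain ⟨-, hsw, hsb⟩ := sum_stepSign_of_numFaces_eq hconn hfw hfb harea hadm
    have hstep := position_ne_of_numFaces_eq hconn hfw hfb harea hadm
    refine ⟨fun e => orderedAt_of_sum_stepSign hfw hne (hsw e) fun h => hstep (D.white e) ?_,
      fun e => orderedAt_of_sum_stepSign hfb hne (hsb e) fun h => hstep (D.black e) ?_⟩
    · rw [perm_inv_apply]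
      exact stepSign_eq_zero.1 h
    · rw [zigzagOf_white_inv, perm_inv_apply]
      exact stepSign_eq_zero.1 h
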